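/- Let $N\in\mathbb N$ and let $A_1,\dots,A_N$ be non-negative random variables on a probability space such that $$P\Big\{\sum_{i=1}^N \mathbf 1\{A_i>0\}\in\{0,1\}\Big\}<1,\qquad \mathbb E\Big[\sum_{i=1}^N \mathbf 1\{A_i>0\}\Big]>1,\qquad P\{A_i\in\{0,1\}\ \text{for all } i=1,\dots,N\}<1 .$$ Put $Q(s)=\mathbb E\big[\sum_{j=1}^N A_j^s\big]-1\in[-1,\infty]$ for $s\ge 0$ (with the convention $0^0=0$) and $\mu(s)=Q(s)/s$ for $s>0$. Fix $\gamma\in(0,2]$ and assume that $\mu(\delta)<\mu(\gamma)<\infty$ for some $\delta>\gamma$. Then: (i) There is a unique probability distribution $\zeta_{\infty,\gamma}$ on $\mathbb R^+=[0,\infty)$ with $\int_{\mathbb R^+} z\,\zeta_{\infty,\gamma}(dz)=1$ whose characteristic function $v(\xi)=\int e^{i\xi z}\,\zeta_{\infty,\gamma}(dz)$ solves $$v(\xi)=\int_0^1 \mathbb E\Big[\prod_{i=1}^N v\big(\xi A_i^\gamma \tau^{Q(\gamma)}\big)\Big]\,d\tau\qquad(\xi\in\mathbb R).$$ (ii) The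 equation $\mu(q)=\mu(\gamma)$ has at most one solution $q=q^*_\gamma\neq\gamma$ in $(0,\infty)$; set $q^*_\gamma:=+\infty$ if $q=\gamma$ is the only solution. (iii) $\zeta_{\infty,\gamma}$ is degenerate (a point mass) if and only if $\sum_{i=1}^N A_i^\gamma=1$ almost surely. Moreover, if $P\{\sum_{i=1}^N A_i^\gamma=1\}<1$ and $p>\gamma$, then $\int_{\mathbb R^+} z^{p/\gamma}\,\zeta_{\infty,\gamma}(dz)<\infty$ if and only if $p<q^*_\gamma$ and $\mu(p)<\infty$ (the condition $\mu(p)<\infty$ is implied by $p<q^*_\gamma$ when $q^*_\gamma<\infty$). -/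

import Mathlib

open MeasureTheory
open scoped ENNReal

noncomputable section

namespace KacLike

variable {Ω : Type*} [MeasurableSpace Ω] {N : ℕ}

/-- The number of indices `i` with `A i ω > 0`. -/
def posCount (A : Fin N → Ω → ℝ) (ω : Ω) : ℕ :=
  ∑ i, if 0 < A i ω then 1 else 0

/-- The standing assumptions on the random weights `A 0, …, A (N - 1)`: they are non-negative random
variables, the number of positive ones is not almost surely `0` or `1` and has mean larger than `1`,
and they are not almost surely all in `{0, 1}`. -/
structure StandingAssumptions (P : Measure Ω) (A : Fin N → Ω → ℝ) : Prop where
  measurable : ∀ i, Measurable (A i)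
  nonneg : ∀ i ω, 0 ≤ A i ω
  count_not_trivial : P {ω | posCount A ω = 0 ∨ posCount A ω = 1} < 1
  one_lt_mean_count : 1 < ∫⁻ ω, (posCount A ω : ℝ≥0∞) ∂P
  not_zero_one : P {ω | ∀ i, A i ω = 0 ∨ A i ω = 1} < 1

/-- `E [∑ j, A j ^ s]` in `[0, ∞]`, for non-negative `A j`, with the convention `0 ^ 0 = 0`. -/
def momentSum (P : Measure Ω) (A : Fin N → Ω → ℝ) (s : ℝ) : ℝ≥0∞ :=
  ∫⁻ ω, ∑ j, (if 0 < A j ω then ENNReal.ofReal (A j ω ^ s) else 0) ∂P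

/-- The convex function `Q s = E [∑ j, A j ^ s] - 1`, with values in `[-1, ∞]`. -/
def Q (P : Measure Ω) (A : Fin N → Ω → ℝ) (s : ℝ) : EReal :=
  (momentSum P A s : EReal) - 1

/-- The spectral function `μ s = Q s / s`, for `s > 0`, with values in `(-∞, ∞]`. -/
def spectral (P : Measure Ω) (A : Fin N → Ω → ℝ) (s : ℝ) : EReal :=
  Q P A s / (s : EReal)

/-- The integral equation
`v ξ = ∫_0^1 E [∏ i, v (ξ * A i ^ γ * τ ^ Q γ)] dτ` for all real `ξ`
(to be used when `Q γ` is finite). -/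
def SolvesEq (P : Measure Ω) (A : Fin N → Ω → ℝ) (γ : ℝ) (v : ℝ → ℂ) : Prop :=
  ∀ ξ : ℝ, v ξ = ∫ τ in (0 : ℝ)..1,
    ∫ ω, ∏ i, v (ξ * A i ω ^ γ * τ ^ (Q P A γ).toReal) ∂P

/-- `ζ` is a probability measure on `[0, ∞)` with mean one whose characteristic function solves
the integral equation. -/
structure IsMeanOneSolution (P : Measure Ω) (A : Fin N → Ω → ℝ) (γ : ℝ) (ζ : Measure ℝ) :
    Prop where
  isProbabilityMeasure : IsProbabilityMeasure ζ
  supported : ζ (Set.Iio 0) = 0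
  integrable : Integrable (fun z : ℝ => z) ζ
  mean_eq_one : ∫ z, z ∂ζ = 1
  solves : SolvesEq P A γ (charFun ζ)

/-- The solutions `q ≠ γ`, `q > 0`, of the equation `μ q = μ γ`. -/
def otherRoots (P : Measure Ω) (A : Fin N → Ω → ℝ) (γ : ℝ) : Set ℝ :=
  {q | 0 < q ∧ q ≠ γ ∧ spectral P A q = spectral P A γ}

/-- The solution `q ≠ γ` of `μ q = μ γ` (there is at most one), and `∞` if there is none. -/
def qStar (P : Measure Ω) (A : Fin N → Ω → ℝ) (γ : ℝ) : EReal :=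
  sInf ((fun q : ℝ => (q : EReal)) '' otherRoots P A γ)

end KacLike

end

/-!
Averaging over a uniform `τ ∈ (0, 1]` as well as over `ω` turns the equation into the fixed-point
equation of the smoothing transform with random weights `T i = A i ^ γ * τ ^ Q γ`. These satisfy
`E [∑ i, T i] = 1` and, for `p > γ`, `E [∑ i, T i ^ (p / γ)] < 1` if and only if `μ p < μ γ`.

At an order `s ∈ (1, 2]` where the moment `E [∑ i, T i ^ s]` is less than one, the transform
contracts `sup |φ ξ - ψ ξ| / |ξ| ^ s` over pairs of characteristic functions of mean-one laws.
This gives uniqueness, and existence as the limit of the iterates started at the Dirac mass at `1`.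
Superadditivity of `x ↦ x ^ s` shows that a nondegenerate fixed point has a finite moment of order
`s > 1` only if `E [∑ i, T i ^ s] < 1`, and an affine recurrence for the moments of the iterates
gives the converse. Finally `s ↦ Q s - s * μ γ` is convex and vanishes at `γ`, so past `γ` it is
negative exactly where it is finite and `s < q*`.
-/

namespace SmoothingTransform

section RealPowers

variable {ι : Type*} [Fintype ι] {s : ℝ}

lemma rpow_eq_mul_rpow_sub_one (hs : s ≠ 0) {x : ℝ} (hx : 0 ≤ x) : x ^ s = x * x ^ (s - 1) := by
  rw [← Real.rpow_one_add' hx (by simpa using hs), add_sub_cancel]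

lemma rpow_add_mul_rpow_sub_one_mul_sub_le (hs : 1 ≤ s) {x y : ℝ} (hx : 0 ≤ x) (hy : 0 < y) :
    y ^ s + s * y ^ (s - 1) * (x - y) ≤ x ^ s := by
  have bernoulli := one_add_mul_self_le_rpow_one_add (s := x / y - 1) (p := s)
    (by linarith [div_nonneg hx hy.le]) hs
  calc y ^ s + s * y ^ (s - 1) * (x - y) = y ^ s * (1 + s * (x / y - 1)) := by
        rw [rpow_eq_mul_rpow_sub_one (by linarith) hy.le]
        field_simp
    _ ≤ y ^ s * (1 + (x / y - 1)) ^ s := by gcongr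
    _ = x ^ s := by
        rw [add_sub_cancel, Real.div_rpow hx hy.le, mul_div_cancel₀ _ (by positivity)]

-- The tangent inequality at the sum, evaluated at its largest summand `x m`, reduces the claim to
-- `(∑ i, x i) ^ (s - 1) ≤ (card ι * x m) ^ (s - 1)`.
lemma rpow_sum_le_sum_rpow_add_cross [DecidableEq ι] (hs : 1 ≤ s) {x : ι → ℝ}
    (hx : ∀ i, 0 ≤ x i) :
    (∑ i, x i) ^ s ≤ ∑ i, x i ^ s
      + s * (Fintype.card ι : ℝ) ^ (s - 1) *
        ∑ i, ∑ j ∈ Finset.univ.erase i, x i ^ (s - 1) * x j := by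
  have cross_nonneg (i) : 0 ≤ ∑ j ∈ Finset.univ.erase i, x i ^ (s - 1) * x j :=
    Finset.sum_nonneg fun j _ => mul_nonneg (Real.rpow_nonneg (hx i) _) (hx j)
  rcases (Finset.sum_nonneg fun i _ => hx i).eq_or_lt with sum_zero | sum_pos
  · rw [← sum_zero, Real.zero_rpow (by linarith)]
    exact add_nonneg (Finset.sum_nonneg fun i _ => Real.rpow_nonneg (hx i) _)
      (mul_nonneg (by positivity) (Finset.sum_nonneg fun i _ => cross_nonneg i))
  obtain ⟨m, -, hm⟩ := Finset.exists_max_image Finset.univ x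
    (Finset.nonempty_of_sum_ne_zero sum_pos.ne')
  have sum_le : ∑ i, x i ≤ Fintype.card ι * x m := by
    simpa using Finset.sum_le_card_nsmul Finset.univ x (x m) hm
  have sum_eq : x m + ∑ j ∈ Finset.univ.erase m, x j = ∑ i, x i :=
    Finset.add_sum_erase _ _ (Finset.mem_univ m)
  have rest_nonneg : 0 ≤ ∑ j ∈ Finset.univ.erase m, x j := Finset.sum_nonneg fun j _ => hx j
  calc (∑ i, x i) ^ s
      ≤ x m ^ s + s * (∑ i, x i) ^ (s - 1) * ∑ j ∈ Finset.univ.erase m, x j := by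
        have tangent := rpow_add_mul_rpow_sub_one_mul_sub_le hs (hx m) sum_pos
        rw [← sum_eq] at tangent ⊢
        linarith
    _ ≤ x m ^ s + s * (Fintype.card ι * x m) ^ (s - 1) * ∑ j ∈ Finset.univ.erase m, x j := by
        gcongr
    _ = x m ^ s + s * (Fintype.card ι : ℝ) ^ (s - 1) *
          ∑ j ∈ Finset.univ.erase m, x m ^ (s - 1) * x j := by
        rw [Real.mul_rpow (by positivity) (hx m), ← Finset.mul_sum]
        ring
    _ ≤ _ := by
        gcongr
        · exact Finset.single_le_sum (f := fun i => x i ^ s)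
            (fun i _ => Real.rpow_nonneg (hx i) _) (Finset.mem_univ m)
        · exact Finset.single_le_sum (fun i _ => cross_nonneg i) (Finset.mem_univ m)

lemma mul_rpow_le_mul_rpow_sum (hs : 1 ≤ s) {x : ι → ℝ} (hx : ∀ i, 0 ≤ x i) (i : ι) :
    x i * x i ^ (s - 1) ≤ x i * (∑ j, x j) ^ (s - 1) :=
  mul_le_mul_of_nonneg_left (Real.rpow_le_rpow (hx i)
    (Finset.single_le_sum (fun j _ => hx j) (Finset.mem_univ i)) (by linarith)) (hx i)

lemma sum_rpow_le_rpow_sum (hs : 1 ≤ s) {x : ι → ℝ} (hx : ∀ i, 0 ≤ x i) :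
    ∑ i, x i ^ s ≤ (∑ i, x i) ^ s := by
  have hs0 : s ≠ 0 := by linarith
  simp only [rpow_eq_mul_rpow_sub_one hs0 (Finset.sum_nonneg fun i _ => hx i), Finset.sum_mul,
    rpow_eq_mul_rpow_sub_one hs0 (hx _)]
  exact Finset.sum_le_sum fun i _ => mul_rpow_le_mul_rpow_sum hs hx i

lemma sum_rpow_lt_rpow_sum (hs : 1 < s) {x : ι → ℝ} (hx : ∀ i, 0 ≤ x i) {k l : ι}
    (hkl : k ≠ l) (hk : 0 < x k) (hl : 0 < x l) :
    ∑ i, x i ^ s < (∑ i, x i) ^ s := by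
  classical
  have hs0 : s ≠ 0 := by linarith
  simp only [rpow_eq_mul_rpow_sub_one hs0 (Finset.sum_nonneg fun i _ => hx i), Finset.sum_mul,
    rpow_eq_mul_rpow_sub_one hs0 (hx _)]
  refine Finset.sum_lt_sum (fun i _ => mul_rpow_le_mul_rpow_sum hs.le hx i)
    ⟨k, Finset.mem_univ k, mul_lt_mul_of_pos_left
      (Real.rpow_lt_rpow (hx k) ?_ (sub_pos.2 hs)) hk⟩
  exact Finset.single_lt_sum hkl.symm (Finset.mem_univ k) (Finset.mem_univ l) hl fun i _ _ => hx i

lemma rpow_sub_one_mul_le (hs : 1 ≤ s) {a b : ℝ} (ha : 0 ≤ a) (hb : 0 ≤ b) :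
    a ^ (s - 1) * b ≤ a ^ s + b ^ s := by
  have hs0 : s ≠ 0 := by linarith
  rcases le_total a b with hab | hba
  · calc a ^ (s - 1) * b ≤ b ^ (s - 1) * b := by gcongr
      _ = b ^ s := by rw [rpow_eq_mul_rpow_sub_one hs0 hb, mul_comm]
      _ ≤ a ^ s + b ^ s := by linarith [Real.rpow_nonneg ha s]
  · calc a ^ (s - 1) * b ≤ a ^ (s - 1) * a := by gcongr
      _ = a ^ s := by rw [rpow_eq_mul_rpow_sub_one hs0 ha, mul_comm]
      _ ≤ a ^ s + b ^ s := by linarith [Real.rpow_nonneg hb s]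

lemma rpow_sub_one_le (hs : 1 ≤ s) {ε z : ℝ} (hε : 0 < ε) (hz : 0 ≤ z) :
    z ^ (s - 1) ≤ ε * z ^ s + ε⁻¹ ^ (s - 1) := by
  rcases le_total z ε⁻¹ with hle | hge
  · have : z ^ (s - 1) ≤ ε⁻¹ ^ (s - 1) := by gcongr
    linarith [mul_nonneg hε.le (Real.rpow_nonneg hz s)]
  · have : 1 ≤ ε * z := by rwa [inv_le_iff_one_le_mul₀' hε] at hge
    calc z ^ (s - 1) ≤ ε * z * z ^ (s - 1) :=
          le_mul_of_one_le_left (Real.rpow_nonneg hz _) this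
      _ = ε * z ^ s := by rw [mul_assoc, ← rpow_eq_mul_rpow_sub_one (by linarith) hz]
      _ ≤ ε * z ^ s + ε⁻¹ ^ (s - 1) := by linarith [Real.rpow_nonneg (inv_pos.2 hε).le (s - 1)]

end RealPowers

section ComplexEstimates

lemma norm_exp_sub_one_sub_le_rpow {s : ℝ} (hs1 : 1 ≤ s) (hs2 : s ≤ 2) (x : ℝ) :
    ‖Complex.exp (x * Complex.I) - 1 - x * Complex.I‖ ≤ 2 * |x| ^ s := by
  rcases le_total |x| 1 with hx | hx
  · calc ‖Complex.exp (x * Complex.I) - 1 - x * Complex.I‖ ≤ ‖(x : ℂ) * Complex.I‖ ^ 2 :=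
          Complex.norm_exp_sub_one_sub_id_le (by simpa using hx)
      _ = |x| ^ (2 : ℝ) := by simp
      _ ≤ |x| ^ s := Real.rpow_le_rpow_of_exponent_ge_of_imp (abs_nonneg x) hx hs2
          fun _ h => absurd h (by linarith)
      _ ≤ 2 * |x| ^ s := by linarith [Real.rpow_nonneg (abs_nonneg x) s]
  · calc ‖Complex.exp (x * Complex.I) - 1 - x * Complex.I‖
        ≤ ‖Complex.exp (x * Complex.I) - 1‖ + ‖(x : ℂ) * Complex.I‖ := norm_sub_le _ _
      _ ≤ |x| + |x| := by
          gcongr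
          · simpa [mul_comm] using Real.norm_exp_I_mul_ofReal_sub_one_le (x := x)
          · simp
      _ = 2 * |x| ^ (1 : ℝ) := by rw [Real.rpow_one]; ring
      _ ≤ 2 * |x| ^ s := by gcongr

lemma norm_prod_sub_prod_le {ι : Type*} (t : Finset ι) {f g : ι → ℂ} (hf : ∀ i, ‖f i‖ ≤ 1)
    (hg : ∀ i, ‖g i‖ ≤ 1) :
    ‖∏ i ∈ t, f i - ∏ i ∈ t, g i‖ ≤ ∑ i ∈ t, ‖f i - g i‖ := by
  classical
  induction t using Finset.induction_on with
  | empty => simp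
  | insert a t ha ih =>
    rw [Finset.prod_insert ha, Finset.prod_insert ha, Finset.sum_insert ha]
    have norm_prod_g : ‖∏ i ∈ t, g i‖ ≤ 1 := by
      rw [norm_prod]
      exact Finset.prod_le_one (fun i _ => norm_nonneg _) fun i _ => hg i
    calc ‖f a * ∏ i ∈ t, f i - g a * ∏ i ∈ t, g i‖
        = ‖f a * (∏ i ∈ t, f i - ∏ i ∈ t, g i) + (f a - g a) * ∏ i ∈ t, g i‖ := by ring_nf
      _ ≤ ‖f a‖ * ‖∏ i ∈ t, f i - ∏ i ∈ t, g i‖ + ‖f a - g a‖ * ‖∏ i ∈ t, g i‖ :=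
          (norm_add_le _ _).trans_eq (by rw [norm_mul, norm_mul])
      _ ≤ 1 * ∑ i ∈ t, ‖f i - g i‖ + ‖f a - g a‖ * 1 := by
          gcongr
          exact hf a
      _ = ‖f a - g a‖ + ∑ i ∈ t, ‖f i - g i‖ := by ring

end ComplexEstimates

section ConvexRoots

variable {D : Set ℝ} {f : ℝ → ℝ}

lemma neg_of_mem_Ioo_of_convexOn (hf : ConvexOn ℝ D f) {a b x : ℝ} (ha : a ∈ D) (hb : b ∈ D)
    (hx : x ∈ Set.Ioo a b) (hfa : f a ≤ 0) (hfb : f b ≤ 0) (hneg : f a < 0 ∨ f b < 0) :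
    f x < 0 := by
  rw [← openSegment_eq_Ioo (hx.1.trans hx.2)] at hx
  obtain ⟨s, t, hs, ht, hst, rfl⟩ := hx
  refine (hf.2 ha hb hs.le ht.le hst).trans_lt ?_
  simp only [smul_eq_mul]
  rcases hneg with h | h <;> nlinarith

variable {a d : ℝ} (hf : ConvexOn ℝ D f) (ha : a ∈ D) (hd : d ∈ D) (had : a < d) (hfa : f a = 0)
  (hfd : f d < 0)

include hf ha hd had hfa hfd

lemma lt_of_convexOn_root {q : ℝ} (hq : q ∈ D) (hfq : f q = 0) (hqa : q ≠ a) : d < q := by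
  by_contra! hqd
  have hqd' : q ≠ d := fun h => by rw [h] at hfq; linarith
  rcases hqa.lt_or_gt with h | h
  · linarith [neg_of_mem_Ioo_of_convexOn hf hq hd ⟨h, had⟩ hfq.le hfd.le (.inr hfd)]
  · linarith [neg_of_mem_Ioo_of_convexOn hf ha hd ⟨h, hqd.lt_of_ne hqd'⟩ hfa.le hfd.le (.inr hfd)]

lemma neg_of_lt_convexOn_root {p q : ℝ} (hq : q ∈ D) (hfq : f q = 0) (hap : a < p) (hpq : p < q) :
    f p < 0 := by
  have hdq : d < q := lt_of_convexOn_root hf ha hd had hfa hfd hq hfq (hap.trans hpq).ne'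
  rcases lt_trichotomy p d with h | rfl | h
  · exact neg_of_mem_Ioo_of_convexOn hf ha hd ⟨hap, h⟩ hfa.le hfd.le (.inr hfd)
  · exact hfd
  · exact neg_of_mem_Ioo_of_convexOn hf hd hq ⟨h, hpq⟩ hfd.le hfq.le (.inl hfd)

lemma convexOn_root_unique {q r : ℝ} (hq : q ∈ D) (hfq : f q = 0) (hqa : q ≠ a) (hr : r ∈ D)
    (hfr : f r = 0) (hra : r ≠ a) : q = r := by
  have haq := had.trans (lt_of_convexOn_root hf ha hd had hfa hfd hq hfq hqa)
  have har := had.trans (lt_of_convexOn_root hf ha hd had hfa hfd hr hfr hra)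
  rcases lt_trichotomy q r with h | h | h
  · exact absurd hfq (neg_of_lt_convexOn_root hf ha hd had hfa hfd hr hfr haq h).ne
  · exact h
  · exact absurd hfr (neg_of_lt_convexOn_root hf ha hd had hfa hfd hq hfq har h).ne

lemma neg_iff_forall_convexOn_root {p : ℝ} (hp : p ∈ D) (hap : a < p)
    (hcont : ContinuousOn f (Set.Icc d p)) :
    f p < 0 ↔ ∀ q ∈ D, q ≠ a → f q = 0 → p < q := by
  constructor
  · intro hfp q hq hqa hfq
    exact lt_of_convexOn_root hf ha hp hap hfa hfp hq hfq hqa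
  · intro h
    by_contra! hfp
    have hdp : d ≤ p := by
      by_contra! hpd
      linarith [neg_of_mem_Ioo_of_convexOn hf ha hd ⟨hap, hpd⟩ hfa.le hfd.le (.inr hfd)]
    obtain ⟨q, ⟨hdq, hqp⟩, hfq⟩ := intermediate_value_Icc hdp hcont ⟨hfd.le, hfp⟩
    exact (h q (hf.1.ordConnected.out hd hp ⟨hdq, hqp⟩) (had.trans_le hdq).ne' hfq).not_ge hqp

end ConvexRoots

open Filter Topology Asymptotics

section DerivativeAtZero

variable {d : ℝ → ℂ} {s : ℝ}

lemma hasDerivAt_zero_of_norm_le_rpow (hs : 1 < s) {C : ℝ} (h : ∀ ξ, ‖d ξ‖ ≤ C * |ξ| ^ s) :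
    HasDerivAt d 0 0 := by
  have h0 : d 0 = 0 := by simpa [Real.zero_rpow (by linarith : s ≠ 0)] using h 0
  rw [hasDerivAt_iff_isLittleO_nhds_zero]
  have hlim : Tendsto (fun ξ : ℝ => C * |ξ| ^ (s - 1)) (𝓝 0) (𝓝 0) := by
    have hc : Continuous fun ξ : ℝ => C * |ξ| ^ (s - 1) :=
      continuous_const.mul (continuous_abs.rpow_const fun _ => Or.inr (by linarith))
    simpa [Real.zero_rpow (by linarith : s - 1 ≠ 0)] using hc.tendsto 0
  refine isLittleO_iff.2 fun ε hε => ?_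
  filter_upwards [hlim.eventually (ge_mem_nhds hε)] with ξ hξ
  calc ‖d (0 + ξ) - d 0 - ξ • (0 : ℂ)‖ ≤ C * |ξ| ^ s := by simpa [h0] using h ξ
    _ = C * |ξ| ^ (s - 1) * |ξ| := by
        rw [rpow_eq_mul_rpow_sub_one (by linarith) (abs_nonneg ξ)]; ring
    _ ≤ ε * ‖ξ‖ := by rw [Real.norm_eq_abs]; gcongr

lemma exists_norm_le_of_hasDerivAt_zero (hs : 0 ≤ s) (hd : HasDerivAt d 0 0) (h0 : d 0 = 0)
    {B : ℝ} (hB : ∀ ξ, ‖d ξ‖ ≤ B) {ε : ℝ} (hε : 0 < ε) :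
    ∃ C, ∀ ξ, ‖d ξ‖ ≤ ε * |ξ| + C * |ξ| ^ s := by
  have hB0 : 0 ≤ B := (norm_nonneg _).trans (hB 0)
  have near : ∀ᶠ ξ in 𝓝 0, ‖d ξ‖ ≤ ε * |ξ| := by
    simpa [h0] using (hasDerivAt_iff_isLittleO_nhds_zero.1 hd).bound hε
  obtain ⟨r, hr, hball⟩ := Metric.eventually_nhds_iff.1 near
  refine ⟨B / r ^ s, fun ξ => ?_⟩
  have hdiv : 0 ≤ B / r ^ s := by positivity
  rcases lt_or_ge |ξ| r with hξ | hξ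
  · linarith [hball (by simpa using hξ), mul_nonneg hdiv (Real.rpow_nonneg (abs_nonneg ξ) s)]
  · calc ‖d ξ‖ ≤ B / r ^ s * r ^ s := by
          rw [div_mul_cancel₀ _ (Real.rpow_pos_of_pos hr s).ne']
          exact hB ξ
      _ ≤ B / r ^ s * |ξ| ^ s := by gcongr
      _ ≤ ε * |ξ| + B / r ^ s * |ξ| ^ s := by linarith [mul_nonneg hε.le (abs_nonneg ξ)]

end DerivativeAtZero

/-- The moment `∫ z ^ s dζ` in `[0, ∞]`, meant for measures `ζ` carried by `[0, ∞)`. -/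
noncomputable def moment (ζ : Measure ℝ) (s : ℝ) : ℝ≥0∞ :=
  ∫⁻ z, ENNReal.ofReal (z ^ s) ∂ζ

/-- Probability measures on `[0, ∞)` with mean one, the laws on which the smoothing transform of
normalized weights acts. -/
structure IsMeanOne (ζ : Measure ℝ) : Prop where
  isProbabilityMeasure : IsProbabilityMeasure ζ
  ae_nonneg : ∀ᵐ z ∂ζ, 0 ≤ z
  moment_one : moment ζ 1 = 1

section Moments

variable {ζ : Measure ℝ}

lemma isMeanOne_dirac_one : IsMeanOne (Measure.dirac 1) where
  isProbabilityMeasure := inferInstance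
  ae_nonneg := by simp [ae_dirac_eq]
  moment_one := by simp [moment, lintegral_dirac]

lemma integrable_rpow_of_moment_lt_top {s : ℝ} (h0 : ∀ᵐ z ∂ζ, 0 ≤ z) (h : moment ζ s < ⊤) :
    Integrable (fun z => z ^ s) ζ := by
  refine ⟨by fun_prop, ?_⟩
  rwa [hasFiniteIntegral_iff_ofReal (h0.mono fun z hz => Real.rpow_nonneg hz s)]

lemma integral_rpow_eq_toReal_moment {s : ℝ} (h0 : ∀ᵐ z ∂ζ, 0 ≤ z) :
    ∫ z, z ^ s ∂ζ = (moment ζ s).toReal :=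
  integral_eq_lintegral_of_nonneg_ae (h0.mono fun z hz => Real.rpow_nonneg hz s) (by fun_prop)

lemma integrable_id_of_moment_one_lt_top (h0 : ∀ᵐ z ∂ζ, 0 ≤ z) (h : moment ζ 1 < ⊤) :
    Integrable id ζ := by
  simpa [Function.id_def] using integrable_rpow_of_moment_lt_top h0 h

lemma hasDerivAt_charFun_zero [IsProbabilityMeasure ζ] (h0 : ∀ᵐ z ∂ζ, 0 ≤ z)
    (h : moment ζ 1 < ⊤) :
    HasDerivAt (charFun ζ) (Complex.I * (moment ζ 1).toReal) 0 := by
  have hL : MemLp id (1 : ℕ) ζ := by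
    simpa [memLp_one_iff_integrable] using integrable_id_of_moment_one_lt_top h0 h
  have hderiv : deriv (charFun ζ) 0 = Complex.I * (moment ζ 1).toReal := by
    simpa [← integral_rpow_eq_toReal_moment h0] using iteratedDeriv_charFun_zero hL
  rw [← hderiv]
  exact ((contDiff_charFun hL).differentiable (by simp)).differentiableAt.hasDerivAt

namespace IsMeanOne

lemma integrable_id (h : IsMeanOne ζ) : Integrable id ζ :=
  integrable_id_of_moment_one_lt_top h.ae_nonneg (by simp [h.moment_one])

lemma integral_id (h : IsMeanOne ζ) : ∫ z, z ∂ζ = 1 := by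
  simpa [h.moment_one] using integral_rpow_eq_toReal_moment (s := 1) h.ae_nonneg

lemma hasDerivAt_charFun_zero (h : IsMeanOne ζ) : HasDerivAt (charFun ζ) Complex.I 0 := by
  have := h.isProbabilityMeasure
  simpa [h.moment_one] using
    SmoothingTransform.hasDerivAt_charFun_zero h.ae_nonneg (by simp [h.moment_one])

lemma exists_norm_charFun_sub_charFun_le {μ ν : Measure ℝ} (hμ : IsMeanOne μ) (hν : IsMeanOne ν)
    {s : ℝ} (hs : 0 ≤ s) {ε : ℝ} (hε : 0 < ε) :
    ∃ C, ∀ ξ, ‖charFun μ ξ - charFun ν ξ‖ ≤ ε * |ξ| + C * |ξ| ^ s := by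
  have := hμ.isProbabilityMeasure
  have := hν.isProbabilityMeasure
  exact exists_norm_le_of_hasDerivAt_zero hs
    ((hμ.hasDerivAt_charFun_zero.sub hν.hasDerivAt_charFun_zero).congr_deriv (sub_self _)) (by simp)
    (fun ξ => norm_sub_le_of_le (norm_charFun_le_one ξ) (norm_charFun_le_one ξ)) hε

lemma norm_charFun_sub_le_rpow (h : IsMeanOne ζ) {s : ℝ} (hs1 : 1 ≤ s) (hs2 : s ≤ 2)
    (hs : moment ζ s < ⊤) (ξ : ℝ) :
    ‖charFun ζ ξ - 1 - ξ * Complex.I‖ ≤ 2 * (moment ζ s).toReal * |ξ| ^ s := by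
  have := h.isProbabilityMeasure
  have hexp : Integrable (fun z : ℝ => Complex.exp ((ξ * z : ℝ) * Complex.I)) ζ :=
    Integrable.of_bound (by fun_prop) 1 (ae_of_all _ fun z => by
      rw [Complex.norm_exp_ofReal_mul_I])
  have hlin : Integrable (fun z : ℝ => ((ξ * z : ℝ) : ℂ) * Complex.I) ζ :=
    ((h.integrable_id.const_mul ξ).ofReal).mul_const _
  have integral_remainder : charFun ζ ξ - 1 - ξ * Complex.I
      = ∫ z, (Complex.exp ((ξ * z : ℝ) * Complex.I) - 1 - (ξ * z : ℝ) * Complex.I) ∂ζ := by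
    rw [integral_sub (f := fun z : ℝ => Complex.exp ((ξ * z : ℝ) * Complex.I) - 1)
        (hexp.sub (integrable_const _)) hlin, integral_sub hexp (integrable_const _),
      integral_mul_const, integral_complex_ofReal, integral_const_mul, h.integral_id,
      charFun_apply_real]
    simp
  calc ‖charFun ζ ξ - 1 - ξ * Complex.I‖
      ≤ ∫ z, ‖Complex.exp ((ξ * z : ℝ) * Complex.I) - 1 - (ξ * z : ℝ) * Complex.I‖ ∂ζ := by
        rw [integral_remainder]
        exact norm_integral_le_integral_norm _
    _ ≤ ∫ z, 2 * |ξ| ^ s * z ^ s ∂ζ := by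
        refine integral_mono_of_nonneg (ae_of_all _ fun z => norm_nonneg _)
          ((integrable_rpow_of_moment_lt_top h.ae_nonneg hs).const_mul _) ?_
        filter_upwards [h.ae_nonneg] with z hz
        refine (norm_exp_sub_one_sub_le_rpow hs1 hs2 _).trans_eq ?_
        rw [abs_mul, Real.mul_rpow (abs_nonneg _) (abs_nonneg _), abs_of_nonneg hz, mul_assoc]
    _ = 2 * (moment ζ s).toReal * |ξ| ^ s := by
        rw [integral_const_mul, integral_rpow_eq_toReal_moment h.ae_nonneg]; ring

end IsMeanOne

end Moments

section WeightMoments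

variable {Ω : Type*} [MeasurableSpace Ω] {ι : Type*} [Fintype ι]

/-- The weight moment `E [∑ i, T i ^ s]` in `[0, ∞]`, meant for non-negative weights `T`. -/
noncomputable def weightMoment (P : Measure Ω) (T : ι → Ω → ℝ) (s : ℝ) : ℝ≥0∞ :=
  ∫⁻ ω, ENNReal.ofReal (∑ i, T i ω ^ s) ∂P

/-- The positive exponents at which the weight moment is finite. The exponent `0` is excluded
because `0 ^ 0 = 1` would spoil convexity there when a weight vanishes. -/
def weightMomentDomain (P : Measure Ω) (T : ι → Ω → ℝ) : Set ℝ :=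
  {s | 0 < s ∧ weightMoment P T s < ⊤}

/-- Non-negative random weights. -/
structure IsNonnegWeights (T : ι → Ω → ℝ) : Prop where
  measurable : ∀ i, Measurable (T i)
  nonneg : ∀ i ω, 0 ≤ T i ω

/-- Non-negative random weights with `E [∑ i, T i] = 1`, so that the smoothing transform preserves
the mean. -/
structure IsNormalizedWeights (P : Measure Ω) (T : ι → Ω → ℝ) : Prop extends
    IsNonnegWeights T where
  weightMoment_one : weightMoment P T 1 = 1

variable {P : Measure Ω} {T : ι → Ω → ℝ} {s : ℝ}

namespace IsNonnegWeights

variable (hT : IsNonnegWeights T)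

include hT

omit [Fintype ι] in
lemma rpow_nonneg (s : ℝ) (i : ι) (ω : Ω) : 0 ≤ T i ω ^ s :=
  Real.rpow_nonneg (hT.nonneg i ω) s

lemma sum_rpow_nonneg (s : ℝ) (ω : Ω) : 0 ≤ ∑ i, T i ω ^ s :=
  Finset.sum_nonneg fun i _ => hT.rpow_nonneg s i ω

lemma measurable_sum_rpow (s : ℝ) : Measurable fun ω => ∑ i, T i ω ^ s :=
  Finset.measurable_sum _ fun i _ => (hT.measurable i).pow_const s

lemma integrable_sum_rpow (hs : weightMoment P T s < ⊤) :
    Integrable (fun ω => ∑ i, T i ω ^ s) P :=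
  ⟨(hT.measurable_sum_rpow s).aestronglyMeasurable,
    (hasFiniteIntegral_iff_ofReal (ae_of_all _ (hT.sum_rpow_nonneg s))).2 hs⟩

lemma integral_sum_rpow (s : ℝ) : ∫ ω, ∑ i, T i ω ^ s ∂P = (weightMoment P T s).toReal :=
  integral_eq_lintegral_of_nonneg_ae (ae_of_all _ (hT.sum_rpow_nonneg s))
    (hT.measurable_sum_rpow s).aestronglyMeasurable

lemma weightMoment_eq_zero_iff (hs : s ≠ 0) :
    weightMoment P T s = 0 ↔ ∀ᵐ ω ∂P, ∀ i, T i ω = 0 := by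
  rw [weightMoment, lintegral_eq_zero_iff (hT.measurable_sum_rpow s).ennreal_ofReal]
  refine eventually_congr (ae_of_all _ fun ω => ?_)
  rw [Pi.zero_apply, ENNReal.ofReal_eq_zero, (hT.sum_rpow_nonneg s ω).ge_iff_eq',
    Finset.sum_eq_zero_iff_of_nonneg fun i _ => hT.rpow_nonneg s i ω]
  simp only [Finset.mem_univ, true_imp_iff, Real.rpow_eq_zero (hT.nonneg _ ω) hs]

end IsNonnegWeights

lemma sum_rpow_eq_rpow_sum_of_subsingleton {x : ι → ℝ} (hx : ∀ i, 0 ≤ x i)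
    (hsub : {i | 0 < x i}.Subsingleton) (hs : s ≠ 0) : ∑ i, x i ^ s = (∑ i, x i) ^ s := by
  by_cases hpos : ∃ i, 0 < x i
  · obtain ⟨i, hi⟩ := hpos
    have zero_of_ne (j : ι) (hj : j ≠ i) : x j = 0 :=
      ((hx j).eq_or_lt.resolve_right fun h => hj (hsub h hi)).symm
    rw [Fintype.sum_eq_single i zero_of_ne, Fintype.sum_eq_single i fun j hj => by
      rw [zero_of_ne j hj, Real.zero_rpow hs]]
  · push Not at hpos
    simp [fun i => (hpos i).antisymm (hx i), Real.zero_rpow hs]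

lemma convexOn_rpow_Ioi {t : ℝ} (ht : 0 ≤ t) : ConvexOn ℝ (Set.Ioi 0) fun s : ℝ => t ^ s := by
  rcases ht.eq_or_lt with rfl | ht
  · exact (convexOn_const 0 (convex_Ioi 0)).congr fun s hs => (Real.zero_rpow hs.ne').symm
  · exact (convexOn_rpow_left ht).subset (Set.subset_univ _) (convex_Ioi 0)

lemma continuousOn_rpow_Ioi {t : ℝ} (ht : 0 ≤ t) :
    ContinuousOn (fun s : ℝ => t ^ s) (Set.Ioi 0) := by
  rcases ht.eq_or_lt with rfl | ht
  · exact continuousOn_const.congr fun s hs => Real.zero_rpow hs.ne'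
  · exact (Real.continuous_const_rpow ht.ne').continuousOn

lemma rpow_le_rpow_add_rpow {t a b : ℝ} (ht : 0 ≤ t) (ha : 0 < a) (has : a ≤ s) (hsb : s ≤ b) :
    t ^ s ≤ t ^ a + t ^ b := by
  rcases le_total t 1 with h | h
  · linarith [Real.rpow_le_rpow_of_exponent_ge_of_imp ht h has fun _ h' => by linarith,
      Real.rpow_nonneg ht b]
  · linarith [Real.rpow_le_rpow_of_exponent_le h hsb, Real.rpow_nonneg ht a]

namespace IsNonnegWeights

variable (hT : IsNonnegWeights T)

include hT

lemma convexOn_toReal_weightMoment :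
    ConvexOn ℝ (weightMomentDomain P T) fun s => (weightMoment P T s).toReal := by
  have bound {x y a b : ℝ} (hx : x ∈ weightMomentDomain P T) (hy : y ∈ weightMomentDomain P T)
      (ha : 0 ≤ a) (hb : 0 ≤ b) (hab : a + b = 1) :
      weightMoment P T (a * x + b * y) ≤
        ENNReal.ofReal (a * (weightMoment P T x).toReal + b * (weightMoment P T y).toReal) := by
    have hix := (hT.integrable_sum_rpow hx.2).const_mul a
    have hiy := (hT.integrable_sum_rpow hy.2).const_mul b
    have integrable_comb :
        Integrable (fun ω => a * ∑ i, T i ω ^ x + b * ∑ i, T i ω ^ y) P := hix.add hiy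
    rw [← hT.integral_sum_rpow, ← hT.integral_sum_rpow, ← integral_const_mul,
      ← integral_const_mul, ← integral_add hix hiy,
      ofReal_integral_eq_lintegral_ofReal integrable_comb (ae_of_all _ fun ω =>
        add_nonneg (mul_nonneg ha (hT.sum_rpow_nonneg x ω))
          (mul_nonneg hb (hT.sum_rpow_nonneg y ω)))]
    refine lintegral_mono fun ω => ENNReal.ofReal_le_ofReal ?_
    rw [Finset.mul_sum, Finset.mul_sum, ← Finset.sum_add_distrib]
    exact Finset.sum_le_sum fun i _ =>
      (convexOn_rpow_Ioi (hT.nonneg i ω)).2 hx.1 hy.1 ha hb hab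
  refine ⟨fun x hx y hy a b ha hb hab => ⟨?_, (bound hx hy ha hb hab).trans_lt
    ENNReal.ofReal_lt_top⟩, fun x hx y hy a b ha hb hab => ?_⟩
  · exact convex_Ioi (0 : ℝ) hx.1 hy.1 ha hb hab
  · exact ENNReal.toReal_le_of_le_ofReal (by positivity) (bound hx hy ha hb hab)

lemma continuousOn_toReal_weightMoment {a b : ℝ} (ha : a ∈ weightMomentDomain P T)
    (hb : b ∈ weightMomentDomain P T) :
    ContinuousOn (fun s => (weightMoment P T s).toReal) (Set.Icc a b) := by
  simp only [← hT.integral_sum_rpow]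
  refine continuousOn_of_dominated (fun s _ => (hT.measurable_sum_rpow s).aestronglyMeasurable)
    (fun s hs => ae_of_all _ fun ω => ?_)
    ((hT.integrable_sum_rpow ha.2).add (hT.integrable_sum_rpow hb.2)) (ae_of_all _ fun ω => ?_)
  · rw [Real.norm_of_nonneg (hT.sum_rpow_nonneg s ω), Pi.add_apply, ← Finset.sum_add_distrib]
    exact Finset.sum_le_sum fun i _ => rpow_le_rpow_add_rpow (hT.nonneg i ω) ha.1 hs.1 hs.2
  · exact continuousOn_finsetSum _ fun i _ =>
      (continuousOn_rpow_Ioi (hT.nonneg i ω)).mono fun s hs => ha.1.trans_le hs.1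

end IsNonnegWeights

namespace IsNormalizedWeights

lemma integrable_sum (hT : IsNormalizedWeights P T) : Integrable (fun ω => ∑ i, T i ω) P := by
  simpa using hT.integrable_sum_rpow (P := P) (s := 1) (by simp [hT.weightMoment_one])

lemma integral_sum (hT : IsNormalizedWeights P T) : ∫ ω, ∑ i, T i ω ∂P = 1 := by
  simpa [hT.weightMoment_one] using hT.integral_sum_rpow (P := P) 1

lemma exists_le_two_weightMoment_lt_one (hT : IsNormalizedWeights P T) (hs : 1 < s)
    (h : weightMoment P T s < 1) : ∃ r, 1 < r ∧ r ≤ 2 ∧ weightMoment P T r < 1 := by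
  rcases le_or_gt s 2 with hs2 | hs2
  · exact ⟨s, hs, hs2, h⟩
  have hconv := hT.convexOn_toReal_weightMoment (P := P)
  have h1 : (1 : ℝ) ∈ weightMomentDomain P T := ⟨one_pos, by simp [hT.weightMoment_one]⟩
  have hsD : s ∈ weightMomentDomain P T := ⟨by linarith, h.trans ENNReal.one_lt_top⟩
  have h2 : (2 : ℝ) ∈ weightMomentDomain P T :=
    hconv.1.ordConnected.out h1 hsD ⟨one_le_two, hs2.le⟩
  have convexOn_sub_one :
      ConvexOn ℝ (weightMomentDomain P T) fun r => (weightMoment P T r).toReal - 1 :=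
    hconv.sub (concaveOn_const 1 hconv.1)
  have toReal_sub_one_neg {r : ℝ} (hr : r ∈ weightMomentDomain P T) :
      (weightMoment P T r).toReal - 1 < 0 ↔ weightMoment P T r < 1 := by
    rw [sub_neg, ← ENNReal.toReal_one, ENNReal.toReal_lt_toReal hr.2.ne ENNReal.one_ne_top]
  refine ⟨2, one_lt_two, le_rfl, (toReal_sub_one_neg h2).1 ?_⟩
  exact neg_of_mem_Ioo_of_convexOn convexOn_sub_one h1 hsD ⟨one_lt_two, hs2⟩
    (by simp [hT.weightMoment_one]) ((toReal_sub_one_neg hsD).2 h).le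
    (.inr ((toReal_sub_one_neg hsD).2 h))

-- With at most one positive weight, Bernoulli's inequality bounds `∑ i, T i ^ s = (∑ i, T i) ^ s`
-- below by a quantity of mean one.
lemma not_ae_subsingleton_of_weightMoment_lt_one [IsProbabilityMeasure P]
    (hT : IsNormalizedWeights P T) (hs : 1 ≤ s) (h : weightMoment P T s < 1) :
    ¬∀ᵐ ω ∂P, {i | 0 < T i ω}.Subsingleton := by
  intro hsub
  have hfin := h.trans ENNReal.one_lt_top
  have hdev : Integrable (fun ω => s * (∑ i, T i ω - 1)) P :=
    (hT.integrable_sum.sub (integrable_const 1)).const_mul s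
  have integral_tangent : ∫ ω, (1 + s * (∑ i, T i ω - 1)) ∂P = 1 := by
    rw [integral_add (integrable_const 1) hdev, integral_const_mul,
      integral_sub hT.integrable_sum (integrable_const 1), hT.integral_sum]
    simp
  have tangent_le : ∫ ω, (1 + s * (∑ i, T i ω - 1)) ∂P ≤ ∫ ω, ∑ i, T i ω ^ s ∂P := by
    refine integral_mono_ae ((integrable_const 1).add hdev) (hT.integrable_sum_rpow hfin) ?_
    filter_upwards [hsub] with ω hω
    have bernoulli := rpow_add_mul_rpow_sub_one_mul_sub_le hs
      (Finset.sum_nonneg fun i (_ : i ∈ Finset.univ) => hT.nonneg i ω) one_pos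
    simpa [sum_rpow_eq_rpow_sum_of_subsingleton (fun i => hT.nonneg i ω) hω
      (by linarith : s ≠ 0)] using bernoulli
  have weightMoment_lt : (weightMoment P T s).toReal < 1 := by
    simpa using (ENNReal.toReal_lt_toReal hfin.ne ENNReal.one_ne_top).2 h
  rw [integral_tangent, hT.integral_sum_rpow] at tangent_le
  linarith

end IsNormalizedWeights

end WeightMoments

section Transform

variable {Ω : Type*} [MeasurableSpace Ω] {ι : Type*} [Fintype ι]

/-- The smoothing transform: the law of `∑ i, T i * Z i`, with the `Z i` independent of law `ζ` and
independent of `T`. -/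
noncomputable def smoothing (P : Measure Ω) (T : ι → Ω → ℝ) (ζ : Measure ℝ) : Measure ℝ :=
  (P.prod (Measure.pi fun _ : ι => ζ)).map fun x => ∑ i, T i x.1 * x.2 i

variable {P : Measure Ω} {T : ι → Ω → ℝ} {s : ℝ}

lemma measurable_weightedSum (hT : ∀ i, Measurable (T i)) :
    Measurable fun x : Ω × (ι → ℝ) => ∑ i, T i x.1 * x.2 i :=
  Finset.measurable_sum _ fun i _ =>
    ((hT i).comp measurable_fst).mul ((measurable_pi_apply i).comp measurable_snd)

lemma isProbabilityMeasure_smoothing [IsProbabilityMeasure P] (hT : ∀ i, Measurable (T i))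
    (ζ : Measure ℝ) [IsProbabilityMeasure ζ] : IsProbabilityMeasure (smoothing P T ζ) :=
  Measure.isProbabilityMeasure_map (measurable_weightedSum hT).aemeasurable

lemma isProbabilityMeasure_iterate_smoothing [IsProbabilityMeasure P]
    (hT : ∀ i, Measurable (T i)) (ζ : Measure ℝ) [IsProbabilityMeasure ζ] (n : ℕ) :
    IsProbabilityMeasure ((smoothing P T)^[n] ζ) := by
  induction n with
  | zero => simpa
  | succ n ih =>
    rw [Function.iterate_succ_apply']
    exact isProbabilityMeasure_smoothing hT _

lemma lintegral_smoothing (hT : ∀ i, Measurable (T i)) (ζ : Measure ℝ) [SigmaFinite ζ]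
    {f : ℝ → ℝ≥0∞} (hf : Measurable f) :
    ∫⁻ z, f z ∂smoothing P T ζ =
      ∫⁻ ω, ∫⁻ z, f (∑ i, T i ω * z i) ∂(Measure.pi fun _ : ι => ζ) ∂P := by
  rw [smoothing, lintegral_map hf (measurable_weightedSum hT), lintegral_prod]
  exact (hf.comp (measurable_weightedSum hT)).aemeasurable

lemma charFun_smoothing [IsFiniteMeasure P] (hT : ∀ i, Measurable (T i)) (ζ : Measure ℝ)
    [IsFiniteMeasure ζ] (ξ : ℝ) :
    charFun (smoothing P T ζ) ξ = ∫ ω, ∏ i, charFun ζ (ξ * T i ω) ∂P := by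
  have hm := measurable_weightedSum hT
  have exp_sum_eq_prod (ω : Ω) (z : ι → ℝ) :
      Complex.exp (ξ * (∑ i, T i ω * z i : ℝ) * Complex.I) =
        ∏ i, Complex.exp ((ξ * T i ω : ℝ) * z i * Complex.I) := by
    rw [← Complex.exp_sum]
    push_cast
    simp only [Finset.mul_sum, Finset.sum_mul, mul_assoc]
  rw [charFun_apply_real, smoothing, integral_map hm.aemeasurable (by fun_prop), integral_prod]
  · refine integral_congr_ae (ae_of_all _ fun ω => ?_)
    simp only [exp_sum_eq_prod, charFun_apply_real]
    exact integral_fintype_prod_eq_prod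
      (f := fun i (z : ℝ) => Complex.exp ((ξ * T i ω : ℝ) * z * Complex.I))
  · refine Integrable.of_bound (Measurable.aestronglyMeasurable (by fun_prop)) 1
      (ae_of_all _ fun x => ?_)
    rw [← Complex.ofReal_mul, Complex.norm_exp_ofReal_mul_I]

lemma integrable_prod_charFun [IsFiniteMeasure P] (hT : ∀ i, Measurable (T i)) (ζ : Measure ℝ)
    [IsProbabilityMeasure ζ] (ξ : ℝ) : Integrable (fun ω => ∏ i, charFun ζ (ξ * T i ω)) P := by
  refine Integrable.of_bound (Measurable.aestronglyMeasurable (by fun_prop)) 1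
    (ae_of_all _ fun ω => ?_)
  rw [norm_prod]
  exact Finset.prod_le_one (fun i _ => norm_nonneg _) fun i _ => norm_charFun_le_one _

lemma smoothing_dirac_one (P : Measure Ω) [SFinite P] (hT : ∀ i, Measurable (T i)) :
    smoothing P T (Measure.dirac 1) = P.map fun ω => ∑ i, T i ω := by
  have pi_dirac : (Measure.pi fun _ : ι => Measure.dirac (1 : ℝ)) = Measure.dirac 1 :=
    Measure.pi_eq fun t ht => by
      simpa [Measure.dirac_apply' _ (MeasurableSet.univ_pi ht), Measure.dirac_apply' _ (ht _)]
        using Set.indicator_pi_one_apply Finset.univ t 1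
  rw [smoothing, pi_dirac, Measure.prod_dirac,
    Measure.map_map (measurable_weightedSum hT) measurable_prodMk_right]
  simp [Function.comp_def]

lemma isFixedPt_smoothing_dirac_one_iff [IsProbabilityMeasure P] (hT : ∀ i, Measurable (T i)) :
    Function.IsFixedPt (smoothing P T) (Measure.dirac 1) ↔ ∀ᵐ ω ∂P, ∑ i, T i ω = 1 := by
  have hS : Measurable fun ω => ∑ i, T i ω := Finset.measurable_sum _ fun i _ => hT i
  rw [Function.IsFixedPt, smoothing_dirac_one P hT]
  refine ⟨fun h => ae_of_ae_map (p := (· = 1)) hS.aemeasurable ?_, fun h => ?_⟩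
  · rw [h]
    exact (ae_dirac_iff (measurableSet_singleton 1)).2 rfl
  · rw [Measure.map_congr (g := fun _ => 1) h, Measure.map_const, measure_univ, one_smul]

namespace IsNormalizedWeights

variable (hT : IsNormalizedWeights P T)

include hT

lemma norm_charFun_smoothing_sub_le [IsFiniteMeasure P] (hs : weightMoment P T s < ⊤)
    {μ ν : Measure ℝ} [IsProbabilityMeasure μ] [IsProbabilityMeasure ν] {a b : ℝ}
    (h : ∀ ξ, ‖charFun μ ξ - charFun ν ξ‖ ≤ a * |ξ| + b * |ξ| ^ s) (ξ : ℝ) :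
    ‖charFun (smoothing P T μ) ξ - charFun (smoothing P T ν) ξ‖ ≤
      a * |ξ| + b * (weightMoment P T s).toReal * |ξ| ^ s := by
  have hi1 := hT.integrable_sum.const_mul (a * |ξ|)
  have his := (hT.integrable_sum_rpow hs).const_mul (b * |ξ| ^ s)
  have norm_prod_sub_le (ω : Ω) : ‖∏ i, charFun μ (ξ * T i ω) - ∏ i, charFun ν (ξ * T i ω)‖ ≤
      a * |ξ| * ∑ i, T i ω + b * |ξ| ^ s * ∑ i, T i ω ^ s := by
    refine (norm_prod_sub_prod_le _ (fun i => norm_charFun_le_one _)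
      fun i => norm_charFun_le_one _).trans ?_
    rw [Finset.mul_sum, Finset.mul_sum, ← Finset.sum_add_distrib]
    refine Finset.sum_le_sum fun i _ => (h _).trans_eq ?_
    rw [abs_mul, abs_of_nonneg (hT.nonneg i ω), Real.mul_rpow (abs_nonneg _) (hT.nonneg i ω)]
    ring
  rw [charFun_smoothing hT.measurable, charFun_smoothing hT.measurable,
    ← integral_sub (integrable_prod_charFun hT.measurable μ ξ)
      (integrable_prod_charFun hT.measurable ν ξ)]
  calc
    _ ≤ ∫ ω, (a * |ξ| * ∑ i, T i ω + b * |ξ| ^ s * ∑ i, T i ω ^ s) ∂P :=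
      norm_integral_le_of_norm_le (hi1.add his) (ae_of_all _ norm_prod_sub_le)
    _ = _ := by
      rw [integral_add hi1 his, integral_const_mul, integral_const_mul, hT.integral_sum,
        hT.integral_sum_rpow]
      ring

lemma norm_charFun_iterate_smoothing_sub_le [IsProbabilityMeasure P]
    (hs : weightMoment P T s < ⊤) {μ ν : Measure ℝ} [IsProbabilityMeasure μ]
    [IsProbabilityMeasure ν] {a b : ℝ}
    (h : ∀ ξ, ‖charFun μ ξ - charFun ν ξ‖ ≤ a * |ξ| + b * |ξ| ^ s) (n : ℕ) (ξ : ℝ) :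
    ‖charFun ((smoothing P T)^[n] μ) ξ - charFun ((smoothing P T)^[n] ν) ξ‖ ≤
      a * |ξ| + b * (weightMoment P T s).toReal ^ n * |ξ| ^ s := by
  induction n generalizing ξ with
  | zero => simpa using h ξ
  | succ n ih =>
    have := isProbabilityMeasure_iterate_smoothing (P := P) hT.measurable
    rw [Function.iterate_succ_apply', Function.iterate_succ_apply', pow_succ, ← mul_assoc]
    exact hT.norm_charFun_smoothing_sub_le hs ih ξ

-- Means agree, so the characteristic functions differ by `ε |ξ| + C |ξ| ^ s` for every `ε`, and
-- iterating the transform removes the second term.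
theorem eq_of_isFixedPt_smoothing [IsProbabilityMeasure P] (hs : 0 ≤ s)
    (h : weightMoment P T s < 1) {μ ν : Measure ℝ} (hμ : IsMeanOne μ) (hν : IsMeanOne ν)
    (hμfix : Function.IsFixedPt (smoothing P T) μ)
    (hνfix : Function.IsFixedPt (smoothing P T) ν) : μ = ν := by
  have := hμ.isProbabilityMeasure
  have := hν.isProbabilityMeasure
  have hm1 : (weightMoment P T s).toReal < 1 := ENNReal.toReal_lt_of_lt_ofReal (by simpa)
  refine Measure.ext_of_charFun (funext fun ξ => eq_of_norm_sub_eq_zero ?_)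
  have norm_sub_le (ε : ℝ) (hε : 0 < ε) : ‖charFun μ ξ - charFun ν ξ‖ ≤ ε * |ξ| := by
    obtain ⟨C, hC⟩ := hμ.exists_norm_charFun_sub_charFun_le hν hs hε
    have hlim : Tendsto (fun n : ℕ => ε * |ξ| + C * (weightMoment P T s).toReal ^ n * |ξ| ^ s)
        atTop (𝓝 (ε * |ξ| + C * 0 * |ξ| ^ s)) :=
      (((tendsto_pow_atTop_nhds_zero_of_lt_one ENNReal.toReal_nonneg hm1).const_mul
        _).mul_const _).const_add _
    rw [mul_zero, zero_mul, add_zero] at hlim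
    refine ge_of_tendsto' hlim fun n => ?_
    simpa only [(hμfix.iterate n).eq, (hνfix.iterate n).eq] using
      hT.norm_charFun_iterate_smoothing_sub_le (h.trans ENNReal.one_lt_top) hC n ξ
  have hlim : Tendsto (fun ε : ℝ => ε * |ξ|) (𝓝[>] 0) (𝓝 0) := by
    simpa using ((continuous_mul_const |ξ|).tendsto 0).mono_left nhdsWithin_le_nhds
  exact (ge_of_tendsto hlim (eventually_mem_nhdsWithin.mono norm_sub_le)).antisymm (norm_nonneg _)

lemma exists_tendsto_charFun_iterate_smoothing [IsProbabilityMeasure P]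
    (h : weightMoment P T s < 1) {μ : Measure ℝ} [IsProbabilityMeasure μ] {C : ℝ}
    (hC : ∀ ξ, ‖charFun μ ξ - charFun (smoothing P T μ) ξ‖ ≤ C * |ξ| ^ s) :
    ∃ f : ℝ → ℂ, (∀ ξ, Tendsto (fun n => charFun ((smoothing P T)^[n] μ) ξ) atTop (𝓝 (f ξ))) ∧
      ∀ ξ, ‖charFun μ ξ - f ξ‖ ≤ C / (1 - (weightMoment P T s).toReal) * |ξ| ^ s := by
  set m := (weightMoment P T s).toReal
  have hm1 : m < 1 := ENNReal.toReal_lt_of_lt_ofReal (by simpa)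
  have := isProbabilityMeasure_smoothing (P := P) hT.measurable μ
  have hgeom (ξ : ℝ) (n : ℕ) : dist (charFun ((smoothing P T)^[n] μ) ξ)
      (charFun ((smoothing P T)^[n + 1] μ) ξ) ≤ C * |ξ| ^ s * m ^ n := by
    rw [dist_eq_norm, Function.iterate_succ_apply]
    have := hT.norm_charFun_iterate_smoothing_sub_le (h.trans ENNReal.one_lt_top)
      (a := 0) (b := C) (by simpa using hC) n ξ
    linarith
  choose f hf using fun ξ =>
    cauchySeq_tendsto_of_complete (cauchySeq_of_le_geometric m _ hm1 (hgeom ξ))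
  refine ⟨f, hf, fun ξ => ?_⟩
  rw [div_mul_eq_mul_div, ← dist_eq_norm]
  exact dist_le_of_le_geometric_of_tendsto₀ m _ hm1 (hgeom ξ) (hf ξ)

end IsNormalizedWeights

end Transform

section MomentBounds

variable {Ω : Type*} [MeasurableSpace Ω] {ι : Type*} [Fintype ι] {P : Measure Ω} {T : ι → Ω → ℝ}
  {ζ : Measure ℝ} {s : ℝ}

lemma ae_pi_nonneg [IsProbabilityMeasure ζ] (h0 : ∀ᵐ z ∂ζ, 0 ≤ z) :
    ∀ᵐ z ∂(Measure.pi fun _ : ι => ζ), ∀ i, 0 ≤ z i :=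
  ae_all_iff.2 fun i => (measurePreserving_eval (fun _ : ι => ζ) i).quasiMeasurePreserving.ae h0

lemma lintegral_pi_eval_mul_eval [IsProbabilityMeasure ζ] {i j : ι} (hij : i ≠ j)
    {f g : ℝ → ℝ≥0∞} (hf : Measurable f) (hg : Measurable g) :
    ∫⁻ z, f (z i) * g (z j) ∂(Measure.pi fun _ : ι => ζ) =
      (∫⁻ z, f z ∂ζ) * ∫⁻ z, g z ∂ζ := by
  have hind : ProbabilityTheory.IndepFun (fun z : ι → ℝ => z i) (fun z => z j)
      (Measure.pi fun _ : ι => ζ) :=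
    (ProbabilityTheory.iIndepFun_pi (X := fun (_ : ι) (z : ℝ) => z)
      fun _ => aemeasurable_id).indepFun hij
  rw [← (measurePreserving_eval (fun _ : ι => ζ) i).lintegral_comp hf,
    ← (measurePreserving_eval (fun _ : ι => ζ) j).lintegral_comp hg]
  exact ProbabilityTheory.lintegral_mul_eq_lintegral_mul_lintegral_of_indepFun
    (hf.comp (measurable_pi_apply i)) (hg.comp (measurable_pi_apply j)) (hind.comp hf hg)

lemma ae_prod_pi_nonneg [IsProbabilityMeasure ζ] (h0 : ∀ᵐ z ∂ζ, 0 ≤ z) :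
    ∀ᵐ x ∂(P.prod (Measure.pi fun _ : ι => ζ)), ∀ i, 0 ≤ x.2 i :=
  Measure.quasiMeasurePreserving_snd.ae (ae_pi_nonneg h0)

lemma IsNonnegWeights.ae_nonneg_smoothing (hT : IsNonnegWeights T) [IsProbabilityMeasure ζ]
    (h0 : ∀ᵐ z ∂ζ, 0 ≤ z) : ∀ᵐ z ∂smoothing P T ζ, 0 ≤ z := by
  rw [smoothing, ae_map_iff (measurable_weightedSum hT.measurable).aemeasurable measurableSet_Ici]
  filter_upwards [ae_prod_pi_nonneg h0] with x hx
  exact Finset.sum_nonneg fun i _ => mul_nonneg (hT.nonneg i _) (hx i)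

lemma IsNonnegWeights.lintegral_sum_rpow_eq (hT : IsNonnegWeights T) [IsProbabilityMeasure ζ]
    (h0 : ∀ᵐ z ∂ζ, 0 ≤ z) (s : ℝ) :
    ∫⁻ ω, ∫⁻ z, ENNReal.ofReal (∑ i, (T i ω * z i) ^ s) ∂(Measure.pi fun _ : ι => ζ) ∂P =
      weightMoment P T s * moment ζ s := by
  rw [weightMoment, ← lintegral_mul_const _ (hT.measurable_sum_rpow s).ennreal_ofReal]
  refine lintegral_congr fun ω => ?_
  have ofReal_sum_eq : (fun z : ι → ℝ => ENNReal.ofReal (∑ i, (T i ω * z i) ^ s))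
      =ᵐ[Measure.pi fun _ => ζ]
      fun z => ∑ i, ENNReal.ofReal (T i ω ^ s) * ENNReal.ofReal (z i ^ s) := by
    filter_upwards [ae_pi_nonneg h0] with z hz
    rw [ENNReal.ofReal_sum_of_nonneg fun i _ =>
      Real.rpow_nonneg (mul_nonneg (hT.nonneg i ω) (hz i)) s]
    refine Finset.sum_congr rfl fun i _ => ?_
    rw [Real.mul_rpow (hT.nonneg i ω) (hz i), ENNReal.ofReal_mul (hT.rpow_nonneg s i ω)]
  rw [lintegral_congr_ae ofReal_sum_eq, lintegral_finsetSum _ (by fun_prop),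
    ENNReal.ofReal_sum_of_nonneg fun i _ => hT.rpow_nonneg s i ω, Finset.sum_mul]
  refine Finset.sum_congr rfl fun i _ => ?_
  rw [lintegral_const_mul _ (by fun_prop), moment,
    ← (measurePreserving_eval (fun _ : ι => ζ) i).lintegral_comp (by fun_prop)]

lemma IsMeanOne.smoothing [IsProbabilityMeasure P] (hT : IsNormalizedWeights P T)
    (h : IsMeanOne ζ) : IsMeanOne (smoothing P T ζ) := by
  have := h.isProbabilityMeasure
  refine ⟨isProbabilityMeasure_smoothing hT.measurable ζ, hT.ae_nonneg_smoothing h.ae_nonneg, ?_⟩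
  rw [moment, lintegral_smoothing hT.measurable ζ (by fun_prop)]
  simpa [h.moment_one, hT.weightMoment_one] using
    hT.lintegral_sum_rpow_eq (P := P) h.ae_nonneg 1

lemma IsMeanOne.iterate_smoothing [IsProbabilityMeasure P] (hT : IsNormalizedWeights P T)
    (h : IsMeanOne ζ) (n : ℕ) : IsMeanOne ((SmoothingTransform.smoothing P T)^[n] ζ) := by
  induction n with
  | zero => exact h
  | succ n ih => simpa only [Function.iterate_succ_apply'] using ih.smoothing hT

lemma moment_sub_one_le [IsProbabilityMeasure ζ] (h0 : ∀ᵐ z ∂ζ, 0 ≤ z) (hs : 1 ≤ s)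
    {ε : ℝ} (hε : 0 < ε) :
    moment ζ (s - 1) ≤ ENNReal.ofReal ε * moment ζ s + ENNReal.ofReal (ε⁻¹ ^ (s - 1)) := by
  calc moment ζ (s - 1)
    _ ≤ ∫⁻ z, (ENNReal.ofReal ε * ENNReal.ofReal (z ^ s) + ENNReal.ofReal (ε⁻¹ ^ (s - 1))) ∂ζ := by
      refine lintegral_mono_ae ?_
      filter_upwards [h0] with z hz
      rw [← ENNReal.ofReal_mul hε.le, ← ENNReal.ofReal_add
        (mul_nonneg hε.le (Real.rpow_nonneg hz s)) (by positivity)]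
      exact ENNReal.ofReal_le_ofReal (rpow_sub_one_le hs hε hz)
    _ = _ := by
      rw [lintegral_add_right _ measurable_const, lintegral_const_mul _ (by fun_prop)]
      simp [moment]

lemma rpow_weightedSum_le [DecidableEq ι] (hs : 1 ≤ s) {t z : ι → ℝ}
    (ht : ∀ i, 0 ≤ t i) (hz : ∀ i, 0 ≤ z i) :
    (∑ i, t i * z i) ^ s ≤ ∑ i, (t i * z i) ^ s + s * (Fintype.card ι : ℝ) ^ (s - 1) *
      (∑ k, t k ^ s) * ∑ i, ∑ j ∈ Finset.univ.erase i, z i ^ (s - 1) * z j := by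
  refine (rpow_sum_le_sum_rpow_add_cross hs fun i => mul_nonneg (ht i) (hz i)).trans ?_
  rw [mul_assoc _ (∑ k, t k ^ s), Finset.mul_sum (a := ∑ k, t k ^ s)]
  gcongr with i _
  rw [Finset.mul_sum]
  refine Finset.sum_le_sum fun j hj => ?_
  have two_terms_le : t i ^ (s - 1) * t j ≤ ∑ k, t k ^ s :=
    calc t i ^ (s - 1) * t j ≤ t i ^ s + t j ^ s := rpow_sub_one_mul_le hs (ht i) (ht j)
      _ ≤ ∑ k, t k ^ s := Finset.add_le_sum (f := fun k => t k ^ s)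
        (fun k _ => Real.rpow_nonneg (ht k) s) (Finset.mem_univ i) (Finset.mem_univ j)
        (Finset.ne_of_mem_erase hj).symm
  calc (t i * z i) ^ (s - 1) * (t j * z j)
    _ = (t i ^ (s - 1) * t j) * (z i ^ (s - 1) * z j) := by
      rw [Real.mul_rpow (ht i) (hz i)]
      ring
    _ ≤ _ := mul_le_mul_of_nonneg_right two_terms_le
      (mul_nonneg (Real.rpow_nonneg (hz i) _) (hz j))

lemma IsMeanOne.lintegral_cross_le [DecidableEq ι] (h : IsMeanOne ζ) (r : ℝ) :
    ∫⁻ z, ENNReal.ofReal (∑ i, ∑ j ∈ Finset.univ.erase i, z i ^ r * z j)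
      ∂(Measure.pi fun _ : ι => ζ) ≤ (Fintype.card ι) ^ 2 * moment ζ r := by
  have := h.isProbabilityMeasure
  have lintegral_pair {i j : ι} (hij : i ≠ j) :
      ∫⁻ z, ENNReal.ofReal (z i ^ r) * ENNReal.ofReal (z j) ∂(Measure.pi fun _ : ι => ζ) =
        moment ζ r := by
    have hmean : ∫⁻ z, ENNReal.ofReal z ∂ζ = 1 := by simpa [moment] using h.moment_one
    rw [lintegral_pi_eval_mul_eval (f := fun z => ENNReal.ofReal (z ^ r)) hij (by fun_prop)
      ENNReal.measurable_ofReal, hmean, mul_one, moment]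
  calc
    _ ≤ ∫⁻ z, ∑ i, ∑ j ∈ Finset.univ.erase i, ENNReal.ofReal (z i ^ r) * ENNReal.ofReal (z j)
        ∂(Measure.pi fun _ : ι => ζ) := by
      refine lintegral_mono_ae ?_
      filter_upwards [ae_pi_nonneg h.ae_nonneg] with z hz
      have term_nonneg (i j : ι) : 0 ≤ z i ^ r * z j :=
        mul_nonneg (Real.rpow_nonneg (hz i) r) (hz j)
      rw [ENNReal.ofReal_sum_of_nonneg fun i _ =>
        Finset.sum_nonneg fun j _ => term_nonneg i j]
      refine Finset.sum_le_sum fun i _ => ?_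
      rw [ENNReal.ofReal_sum_of_nonneg fun j _ => term_nonneg i j]
      exact Finset.sum_le_sum fun _ _ => (ENNReal.ofReal_mul (Real.rpow_nonneg (hz i) r)).le
    _ = ∑ i, ∑ _j ∈ Finset.univ.erase i, moment ζ r := by
      rw [lintegral_finsetSum _ (by fun_prop)]
      refine Finset.sum_congr rfl fun i _ => ?_
      rw [lintegral_finsetSum _ (by fun_prop)]
      exact Finset.sum_congr rfl fun _ hj => lintegral_pair (Finset.ne_of_mem_erase hj).symm
    _ ≤ ∑ _i : ι, ∑ _j : ι, moment ζ r := by gcongr; exact Finset.erase_subset _ _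
    _ = _ := by simp [← mul_assoc, sq]

lemma moment_smoothing_le (hT : IsNonnegWeights T) (h : IsMeanOne ζ) (hs : 1 ≤ s) :
    moment (smoothing P T ζ) s ≤ weightMoment P T s * (moment ζ s +
      ENNReal.ofReal (s * (Fintype.card ι : ℝ) ^ (s - 1)) * (Fintype.card ι) ^ 2 *
        moment ζ (s - 1)) := by
  classical
  have := h.isProbabilityMeasure
  set c := s * (Fintype.card ι : ℝ) ^ (s - 1)
  have hc : 0 ≤ c := by positivity
  have inner_le (ω : Ω) :
      ∫⁻ z, ENNReal.ofReal ((∑ i, T i ω * z i) ^ s) ∂(Measure.pi fun _ : ι => ζ) ≤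
        ∫⁻ z, ENNReal.ofReal (∑ i, (T i ω * z i) ^ s) ∂(Measure.pi fun _ : ι => ζ) +
          ENNReal.ofReal (∑ i, T i ω ^ s) *
            (ENNReal.ofReal c * (Fintype.card ι ^ 2 * moment ζ (s - 1))) := by
    grw [← h.lintegral_cross_le]
    rw [← lintegral_const_mul _ (by fun_prop), ← lintegral_const_mul _ (by fun_prop),
      ← lintegral_add_right _ (by fun_prop)]
    refine lintegral_mono_ae ?_
    filter_upwards [ae_pi_nonneg h.ae_nonneg] with z hz
    rw [← mul_assoc, ← ENNReal.ofReal_mul (hT.sum_rpow_nonneg s ω), ← ENNReal.ofReal_mul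
      (mul_nonneg (hT.sum_rpow_nonneg s ω) hc), mul_comm _ c]
    grw [← ENNReal.ofReal_add_le]
    exact ENNReal.ofReal_le_ofReal (rpow_weightedSum_le hs (fun i => hT.nonneg i ω) hz)
  calc moment (smoothing P T ζ) s
    _ = ∫⁻ ω, ∫⁻ z, ENNReal.ofReal ((∑ i, T i ω * z i) ^ s) ∂(Measure.pi fun _ : ι => ζ) ∂P := by
      rw [moment, lintegral_smoothing hT.measurable ζ (by fun_prop)]
    _ ≤ _ := lintegral_mono inner_le
    _ = _ := by
      rw [lintegral_add_right _ ((hT.measurable_sum_rpow s).ennreal_ofReal.mul_const _),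
        hT.lintegral_sum_rpow_eq h.ae_nonneg,
        lintegral_mul_const _ (hT.measurable_sum_rpow s).ennreal_ofReal, ← weightMoment]
      ring

lemma exists_moment_smoothing_le_affine (hT : IsNonnegWeights T) (hs : 1 ≤ s)
    (h : weightMoment P T s < 1) :
    ∃ κ < 1, ∃ D < ⊤, ∀ ζ, IsMeanOne ζ → moment (smoothing P T ζ) s ≤ κ * moment ζ s + D := by
  set w := weightMoment P T s
  set c := ENNReal.ofReal (s * (Fintype.card ι : ℝ) ^ (s - 1)) * (Fintype.card ι) ^ 2
  have hc : c < ⊤ := ENNReal.mul_lt_top ENNReal.ofReal_lt_top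
    (ENNReal.pow_lt_top (ENNReal.natCast_lt_top _))
  have hwc : w * c < ⊤ := ENNReal.mul_lt_top (h.trans ENNReal.one_lt_top) hc
  obtain ⟨ε, hε, hεlt⟩ := ENNReal.exists_nnreal_pos_mul_lt hwc.ne (tsub_pos_of_lt h).ne'
  refine ⟨w + ε * (w * c), lt_tsub_iff_left.1 hεlt, w * c * ENNReal.ofReal ((ε : ℝ)⁻¹ ^ (s - 1)),
    ENNReal.mul_lt_top hwc ENNReal.ofReal_lt_top, fun ζ hζ => ?_⟩
  have := hζ.isProbabilityMeasure
  calc moment (smoothing P T ζ) s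
    _ ≤ w * (moment ζ s + c * moment ζ (s - 1)) := moment_smoothing_le hT hζ hs
    _ ≤ w * (moment ζ s + c * (ε * moment ζ s + ENNReal.ofReal ((ε : ℝ)⁻¹ ^ (s - 1)))) := by
      gcongr
      simpa only [ENNReal.ofReal_coe_nnreal] using
        moment_sub_one_le hζ.ae_nonneg hs (NNReal.coe_pos.2 hε)
    _ = _ := by ring

lemma le_of_affine_recurrence {u : ℕ → ℝ≥0∞} {κ D : ℝ≥0∞} (hκ : κ < 1)
    (hu : ∀ n, u (n + 1) ≤ κ * u n + D) (n : ℕ) : u n ≤ u 0 + (1 - κ)⁻¹ * D := by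
  have hinv : κ * (1 - κ)⁻¹ + 1 = (1 - κ)⁻¹ := by
    nth_rw 2 [← ENNReal.mul_inv_cancel (a := 1 - κ) (tsub_pos_of_lt hκ).ne' (by finiteness)]
    rw [← add_mul, add_tsub_cancel_of_le hκ.le, one_mul]
  induction n with
  | zero => exact le_self_add
  | succ n ih =>
    calc u (n + 1) ≤ κ * u n + D := hu n
      _ ≤ κ * (u 0 + (1 - κ)⁻¹ * D) + D := by gcongr
      _ = κ * u 0 + (κ * (1 - κ)⁻¹ + 1) * D := by ring
      _ ≤ u 0 + (1 - κ)⁻¹ * D := by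
        rw [hinv]
        gcongr
        exact mul_le_of_le_one_left zero_le hκ.le

lemma exists_moment_iterate_smoothing_le [IsProbabilityMeasure P] (hT : IsNormalizedWeights P T)
    (hs : 1 ≤ s) (h : weightMoment P T s < 1) (hζ : IsMeanOne ζ) (hfin : moment ζ s < ⊤) :
    ∃ B < ⊤, ∀ n, moment ((smoothing P T)^[n] ζ) s ≤ B := by
  obtain ⟨κ, hκ, D, hD, hstep⟩ :=
    exists_moment_smoothing_le_affine hT.toIsNonnegWeights hs h
  refine ⟨moment ζ s + (1 - κ)⁻¹ * D, ENNReal.add_lt_top.2 ⟨hfin, ENNReal.mul_lt_top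
    (ENNReal.inv_lt_top.2 (tsub_pos_of_lt hκ)) hD⟩, ?_⟩
  exact le_of_affine_recurrence (u := fun n => moment ((smoothing P T)^[n] ζ) s) hκ fun n => by
    simpa only [Function.iterate_succ_apply'] using hstep _ (hζ.iterate_smoothing hT n)

end MomentBounds

section Strictness

variable {Ω : Type*} [MeasurableSpace Ω] {ι : Type*} [Fintype ι] {P : Measure Ω} {T : ι → Ω → ℝ}
  {ζ : Measure ℝ} {s : ℝ}

lemma measure_Ioi_ne_zero_of_moment_ne_zero (hs : s ≠ 0) (h0 : ∀ᵐ z ∂ζ, 0 ≤ z)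
    (h : moment ζ s ≠ 0) : ζ (Set.Ioi 0) ≠ 0 := by
  contrapose! h
  refine lintegral_eq_zero_of_ae_eq_zero ?_
  filter_upwards [h0, measure_eq_zero_iff_ae_notMem.1 h] with z hz hz'
  simp [(not_lt.1 hz').antisymm hz, Real.zero_rpow hs]

lemma moment_ne_zero_of_measure_Ioi_ne_zero (h : ζ (Set.Ioi 0) ≠ 0) (s : ℝ) :
    moment ζ s ≠ 0 := by
  contrapose! h
  rw [moment, lintegral_eq_zero_iff (by fun_prop)] at h
  refine measure_eq_zero_iff_ae_notMem.2 ?_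
  filter_upwards [h] with z hz hz0
  exact (ENNReal.ofReal_pos.2 (Real.rpow_pos_of_pos hz0 s)).ne' hz

lemma subsingleton_of_ae_sum_rpow_eq [SigmaFinite ζ] (hs : 1 < s) (hζ : ζ (Set.Ioi 0) ≠ 0)
    {t : ι → ℝ} (ht : ∀ i, 0 ≤ t i)
    (h : ∀ᵐ z ∂(Measure.pi fun _ : ι => ζ), ∑ i, (t i * z i) ^ s = (∑ i, t i * z i) ^ s) :
    {i | 0 < t i}.Subsingleton := by
  intro i hi j hj
  by_contra hij
  have box_ne_zero : (Measure.pi fun _ : ι => ζ) (Set.univ.pi fun _ => Set.Ioi 0) ≠ 0 := by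
    rw [Measure.pi_pi, Finset.prod_const]
    exact pow_ne_zero _ hζ
  obtain ⟨z, hz, heq⟩ := ((frequently_ae_mem_iff.2 box_ne_zero).and_eventually
    h).exists
  have hz0 (k : ι) : 0 < z k := hz k (Set.mem_univ k)
  exact (sum_rpow_lt_rpow_sum hs (fun k => mul_nonneg (ht k) (hz0 k).le) hij
    (mul_pos hi (hz0 i)) (mul_pos hj (hz0 j))).ne heq

lemma ae_eq_of_ae_le_of_lintegral_ofReal_le {α : Type*} [MeasurableSpace α] {ρ : Measure α}
    {f g : α → ℝ} (hf : 0 ≤ᵐ[ρ] f) (hfg : f ≤ᵐ[ρ] g) (hfin : ∫⁻ x, ENNReal.ofReal (f x) ∂ρ ≠ ⊤)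
    (hg : AEMeasurable g ρ)
    (h : ∫⁻ x, ENNReal.ofReal (g x) ∂ρ ≤ ∫⁻ x, ENNReal.ofReal (f x) ∂ρ) : f =ᵐ[ρ] g := by
  have ofReal_eq := ae_eq_of_ae_le_of_lintegral_le
    (hfg.mono fun _ => ENNReal.ofReal_le_ofReal) hfin hg.ennreal_ofReal h
  filter_upwards [hf, hfg, ofReal_eq] with x hx hfgx hx'
  exact (ENNReal.ofReal_eq_ofReal_iff hx (hx.trans hfgx)).1 hx'

-- At a fixed point, superadditivity of `x ↦ x ^ s` gives `E [∑ i, T i ^ s] * m ≤ m` for the moment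
-- `m` of order `s`, with equality only if almost surely at most one weight is positive.
theorem weightMoment_lt_one_of_isFixedPt (hT : IsNonnegWeights T)
    (hsub : ¬∀ᵐ ω ∂P, {i | 0 < T i ω}.Subsingleton) (h : IsMeanOne ζ)
    (hfix : Function.IsFixedPt (smoothing P T) ζ) (hs : 1 < s) (hfin : moment ζ s < ⊤) :
    weightMoment P T s < 1 := by
  have := h.isProbabilityMeasure
  have hm := hT.measurable
  have hζ : ζ (Set.Ioi 0) ≠ 0 := measure_Ioi_ne_zero_of_moment_ne_zero one_ne_zero h.ae_nonneg
    (h.moment_one ▸ one_ne_zero)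
  have hpos := moment_ne_zero_of_measure_Ioi_ne_zero hζ s
  set ρ := P.prod (Measure.pi fun _ : ι => ζ)
  set F : Ω × (ι → ℝ) → ℝ := fun x => ∑ i, (T i x.1 * x.2 i) ^ s
  set G : Ω × (ι → ℝ) → ℝ := fun x => (∑ i, T i x.1 * x.2 i) ^ s
  have lintegral_F : ∫⁻ x, ENNReal.ofReal (F x) ∂ρ = weightMoment P T s * moment ζ s := by
    rw [← hT.lintegral_sum_rpow_eq h.ae_nonneg, lintegral_prod _ (by fun_prop)]
  have lintegral_G : ∫⁻ x, ENNReal.ofReal (G x) ∂ρ = moment ζ s := by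
    conv_rhs => rw [← hfix.eq]
    rw [moment, smoothing, lintegral_map (by fun_prop) (measurable_weightedSum hm)]
  have summand_nonneg : ∀ᵐ x ∂ρ, ∀ i, 0 ≤ T i x.1 * x.2 i :=
    (ae_prod_pi_nonneg h.ae_nonneg).mono fun x hx i => mul_nonneg (hT.nonneg i _) (hx i)
  have F_nonneg : 0 ≤ᵐ[ρ] F := summand_nonneg.mono fun x hx =>
    Finset.sum_nonneg fun i _ => Real.rpow_nonneg (hx i) s
  have F_le_G : F ≤ᵐ[ρ] G := summand_nonneg.mono fun x hx => sum_rpow_le_rpow_sum hs.le hx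
  have weightMoment_le : weightMoment P T s ≤ 1 := by
    refine (ENNReal.mul_le_mul_iff_left hpos hfin.ne).1 ?_
    rw [← lintegral_F, one_mul, ← lintegral_G]
    exact lintegral_mono_ae (F_le_G.mono fun _ => ENNReal.ofReal_le_ofReal)
  refine weightMoment_le.lt_of_ne fun heq => hsub ?_
  have F_eq_G : F =ᵐ[ρ] G := ae_eq_of_ae_le_of_lintegral_ofReal_le F_nonneg F_le_G
    (by rw [lintegral_F, heq, one_mul]; exact hfin.ne) (by fun_prop)
    (by rw [lintegral_F, lintegral_G, heq, one_mul])
  filter_upwards [Measure.ae_ae_of_ae_prod F_eq_G] with ω hω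
  exact subsingleton_of_ae_sum_rpow_eq hs hζ (fun i => hT.nonneg i ω) hω

end Strictness

section WeakLimits

variable {μ : ℕ → ProbabilityMeasure ℝ} {ν : ProbabilityMeasure ℝ}

lemma exists_probabilityMeasure_tendsto_of_tendsto_charFun {f : ℝ → ℂ} (hf : ContinuousAt f 0)
    (h : ∀ t, Tendsto (fun n => charFun (μ n : Measure ℝ) t) atTop (𝓝 (f t))) :
    ∃ ν : ProbabilityMeasure ℝ, Tendsto μ atTop (𝓝 ν) ∧ charFun (ν : Measure ℝ) = f := by
  have htight : IsTightMeasureSet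
      {((κ : ProbabilityMeasure ℝ) : Measure ℝ) | κ ∈ Set.range μ} := by
    convert! isTightMeasureSet_of_tendsto_charFun (μ := fun n => (μ n : Measure ℝ)) hf h using 1
    ext κ
    simp
  obtain ⟨ν, -, hν⟩ := (isCompact_closure_of_isTightMeasureSet htight).exists_mapClusterPt
    (f := atTop) (u := μ)
    (le_principal_iff.2 (mem_map.2 (univ_mem' fun n => subset_closure (Set.mem_range_self n))))
  have hchar : charFun (ν : Measure ℝ) = f := by
    funext t
    have hcont : ContinuousAt (fun κ : ProbabilityMeasure ℝ => charFun (κ : Measure ℝ) t) ν := by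
      simpa only [ContinuousAt, charFun_eq_integral_innerProbChar] using
        (ProbabilityMeasure.tendsto_iff_forall_integral_rclike_tendsto ℂ
          (μs := fun κ : ProbabilityMeasure ℝ => κ)).1 (tendsto_id (x := 𝓝 ν))
          (BoundedContinuousFunction.innerProbChar t)
    exact eq_of_nhds_neBot ((hν.continuousAt_comp hcont).clusterPt.mono (h t))
  exact ⟨ν, ProbabilityMeasure.tendsto_of_tendsto_charFun (hchar ▸ h), hchar⟩

lemma ae_nonneg_of_tendsto (h : Tendsto μ atTop (𝓝 ν))
    (h0 : ∀ n, ∀ᵐ z ∂(μ n : Measure ℝ), 0 ≤ z) : ∀ᵐ z ∂(ν : Measure ℝ), 0 ≤ z := by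
  have hopen := ProbabilityMeasure.le_liminf_measure_open_of_tendsto h (isOpen_Iio (a := (0 : ℝ)))
  simp only [ae_iff, not_le] at h0
  simp only [Set.Iio, h0, liminf_const, nonpos_iff_eq_zero] at hopen
  simpa only [ae_iff, not_le] using hopen

-- Weak convergence bounds integrals of continuous functions only; on `[0, ∞)` the integrand
-- `z ^ s` agrees with the continuous function `max z 0 ^ s`.
lemma moment_le_of_tendsto (h : Tendsto μ atTop (𝓝 ν))
    (h0 : ∀ n, ∀ᵐ z ∂(μ n : Measure ℝ), 0 ≤ z) {s : ℝ} (hs : 0 ≤ s) {B : ℝ≥0∞}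
    (hB : ∀ n, moment (μ n : Measure ℝ) s ≤ B) : moment (ν : Measure ℝ) s ≤ B := by
  have moment_eq (κ : Measure ℝ) (hκ : ∀ᵐ z ∂κ, 0 ≤ z) :
      moment κ s = ∫⁻ z, ENNReal.ofReal (max z 0 ^ s) ∂κ := by
    refine lintegral_congr_ae ?_
    filter_upwards [hκ] with z hz
    rw [max_eq_left hz]
  calc moment (ν : Measure ℝ) s
    _ = ∫⁻ z, ENNReal.ofReal (max z 0 ^ s) ∂ν := moment_eq _ (ae_nonneg_of_tendsto h h0)
    _ ≤ liminf (fun n => ∫⁻ z, ENNReal.ofReal (max z 0 ^ s) ∂(μ n)) atTop :=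
      lintegral_le_liminf_lintegral_of_forall_isOpen_measure_le_liminf_measure
        ((continuous_id.max continuous_const).rpow_const fun _ => .inr hs)
        (fun z => Real.rpow_nonneg (le_max_right _ _) _)
        fun G hG => ProbabilityMeasure.le_liminf_measure_open_of_tendsto h hG
    _ ≤ B := liminf_le_of_frequently_le'
      (Frequently.of_forall fun n => (moment_eq _ (h0 n)).symm.trans_le (hB n))

-- Fatou only gives mean at most one; the derivative of the characteristic function recovers it.
lemma isMeanOne_of_tendsto (h : Tendsto μ atTop (𝓝 ν)) (hμ : ∀ n, IsMeanOne (μ n : Measure ℝ))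
    (hν : HasDerivAt (charFun (ν : Measure ℝ)) Complex.I 0) : IsMeanOne (ν : Measure ℝ) := by
  have h0 := ae_nonneg_of_tendsto h fun n => (hμ n).ae_nonneg
  have hlt : moment (ν : Measure ℝ) 1 < ⊤ := (moment_le_of_tendsto h (fun n => (hμ n).ae_nonneg)
    zero_le_one fun n => (hμ n).moment_one.le).trans_lt ENNReal.one_lt_top
  refine ⟨inferInstance, h0, ?_⟩
  have hderiv := (hasDerivAt_charFun_zero h0 hlt).unique hν
  rw [← ENNReal.toReal_eq_one_iff, ← Complex.ofReal_eq_one]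
  exact mul_left_cancel₀ Complex.I_ne_zero (hderiv.trans (mul_one _).symm)

end WeakLimits

section Existence

variable {Ω : Type*} [MeasurableSpace Ω] {ι : Type*} [Fintype ι] {P : Measure Ω} {T : ι → Ω → ℝ}
  {s : ℝ}

lemma tendsto_charFun_smoothing [IsFiniteMeasure P] (hT : ∀ i, Measurable (T i))
    {μ : ℕ → Measure ℝ} {ν : Measure ℝ} [∀ n, IsProbabilityMeasure (μ n)]
    [IsProbabilityMeasure ν]
    (h : ∀ t, Tendsto (fun n => charFun (μ n) t) atTop (𝓝 (charFun ν t))) (ξ : ℝ) :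
    Tendsto (fun n => charFun (smoothing P T (μ n)) ξ) atTop
      (𝓝 (charFun (smoothing P T ν) ξ)) := by
  simp only [charFun_smoothing hT]
  refine tendsto_integral_of_dominated_convergence (fun _ => 1)
    (fun n => (integrable_prod_charFun hT (μ n) ξ).aestronglyMeasurable) (integrable_const _)
    (fun n => ae_of_all _ fun ω => ?_) (ae_of_all _ fun ω => tendsto_finsetProd _ fun i _ => h _)
  rw [norm_prod]
  exact Finset.prod_le_one (fun i _ => norm_nonneg _) fun i _ => norm_charFun_le_one _

lemma IsMeanOne.norm_charFun_sub_charFun_le_rpow {μ ν : Measure ℝ} (hμ : IsMeanOne μ)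
    (hν : IsMeanOne ν) (hs1 : 1 ≤ s) (hs2 : s ≤ 2) (hμs : moment μ s < ⊤) (hνs : moment ν s < ⊤)
    (ξ : ℝ) :
    ‖charFun μ ξ - charFun ν ξ‖ ≤
      2 * ((moment μ s).toReal + (moment ν s).toReal) * |ξ| ^ s := by
  calc ‖charFun μ ξ - charFun ν ξ‖
    _ = ‖(charFun μ ξ - 1 - ξ * Complex.I) - (charFun ν ξ - 1 - ξ * Complex.I)‖ := by
      congr 1
      ring
    _ ≤ 2 * (moment μ s).toReal * |ξ| ^ s + 2 * (moment ν s).toReal * |ξ| ^ s :=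
      (norm_sub_le _ _).trans (add_le_add (hμ.norm_charFun_sub_le_rpow hs1 hs2 hμs ξ)
        (hν.norm_charFun_sub_le_rpow hs1 hs2 hνs ξ))
    _ = _ := by ring

lemma exists_tendsto_charFun_iterate_smoothing_dirac_one [IsProbabilityMeasure P]
    (hT : IsNormalizedWeights P T) (hs : 1 < s) (h : weightMoment P T s < 1) :
    ∃ f : ℝ → ℂ, HasDerivAt f Complex.I 0 ∧ ∀ ξ,
      Tendsto (fun n => charFun ((smoothing P T)^[n] (Measure.dirac 1)) ξ) atTop (𝓝 (f ξ)) := by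
  obtain ⟨r, hr1, hr2, hr⟩ := hT.exists_le_two_weightMoment_lt_one hs h
  have hδ : moment (Measure.dirac 1) r < ⊤ := by simp [moment]
  obtain ⟨B, hB, hmoment⟩ :=
    exists_moment_iterate_smoothing_le hT hr1.le hr isMeanOne_dirac_one hδ
  obtain ⟨f, hf, hle⟩ := hT.exists_tendsto_charFun_iterate_smoothing hr
    (isMeanOne_dirac_one.norm_charFun_sub_charFun_le_rpow (isMeanOne_dirac_one.smoothing hT)
      hr1.le hr2 hδ ((hmoment 1).trans_lt hB))
  refine ⟨f, ?_, hf⟩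
  have hderiv := isMeanOne_dirac_one.hasDerivAt_charFun_zero.sub
    (hasDerivAt_zero_of_norm_le_rpow hr1 hle)
  rw [sub_zero] at hderiv
  exact hderiv.congr_of_eventuallyEq (.of_forall fun ξ => (sub_sub_cancel _ _).symm)

theorem exists_isMeanOne_isFixedPt_smoothing [IsProbabilityMeasure P]
    (hT : IsNormalizedWeights P T) (hs : 1 < s) (h : weightMoment P T s < 1) :
    ∃ ζ, IsMeanOne ζ ∧ Function.IsFixedPt (smoothing P T) ζ ∧
      ∀ p, 1 ≤ p → weightMoment P T p < 1 → moment ζ p < ⊤ := by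
  obtain ⟨f, hderiv, hf⟩ := exists_tendsto_charFun_iterate_smoothing_dirac_one hT hs h
  have hone := isMeanOne_dirac_one.iterate_smoothing hT
  have hprob (n : ℕ) := (hone n).isProbabilityMeasure
  obtain ⟨ν, hν, rfl⟩ := exists_probabilityMeasure_tendsto_of_tendsto_charFun
    (μ := fun n => ⟨_, hprob n⟩) hderiv.continuousAt hf
  refine ⟨ν, isMeanOne_of_tendsto hν hone hderiv, ?_, fun p hp hwp => ?_⟩
  · have := isProbabilityMeasure_smoothing (P := P) hT.measurable (ν : Measure ℝ)
    refine Measure.ext_of_charFun (funext fun ξ => ?_)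
    refine tendsto_nhds_unique (tendsto_charFun_smoothing hT.measurable hf ξ) ?_
    simpa only [Function.iterate_succ_apply'] using (tendsto_add_atTop_iff_nat 1).2 (hf ξ)
  · obtain ⟨B, hB, hmoment⟩ := exists_moment_iterate_smoothing_le hT hp hwp isMeanOne_dirac_one
      (by simp [moment])
    exact (moment_le_of_tendsto hν (fun n => (hone n).ae_nonneg) (by linarith) hmoment).trans_lt hB

end Existence

section Degenerate

variable {Ω : Type*} [MeasurableSpace Ω] {ι : Type*} [Fintype ι] {P : Measure Ω} {T : ι → Ω → ℝ}
  {ζ : Measure ℝ} {s : ℝ}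

lemma IsMeanOne.eq_dirac_one {c : ℝ} (h : IsMeanOne (Measure.dirac c)) : c = 1 := by
  simpa using h.integral_id

lemma exists_eq_dirac_iff_ae_sum_eq_one [IsProbabilityMeasure P] (hT : IsNormalizedWeights P T)
    (hs : 0 ≤ s) (h : weightMoment P T s < 1) (hζ : IsMeanOne ζ)
    (hfix : Function.IsFixedPt (smoothing P T) ζ) :
    (∃ c, ζ = Measure.dirac c) ↔ ∀ᵐ ω ∂P, ∑ i, T i ω = 1 := by
  rw [← isFixedPt_smoothing_dirac_one_iff hT.measurable]
  constructor
  · rintro ⟨c, rfl⟩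
    rwa [← hζ.eq_dirac_one]
  · exact fun hdirac =>
      ⟨1, hT.eq_of_isFixedPt_smoothing hs h hζ isMeanOne_dirac_one hfix hdirac⟩

end Degenerate

end SmoothingTransform

namespace KacLike

open SmoothingTransform

variable {Ω : Type*} [MeasurableSpace Ω] {N : ℕ} {P : Measure Ω} {A : Fin N → Ω → ℝ} {γ δ p s : ℝ}

section Spectral

lemma momentSum_eq_weightMoment (hA : IsNonnegWeights A) (hs : s ≠ 0) :
    momentSum P A s = weightMoment P A s := by
  refine lintegral_congr fun ω => ?_
  rw [ENNReal.ofReal_sum_of_nonneg fun i _ => hA.rpow_nonneg s i ω]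
  refine Finset.sum_congr rfl fun j _ => ?_
  split_ifs with hj
  · rfl
  · rw [(not_lt.1 hj).antisymm (hA.nonneg j ω), Real.zero_rpow hs, ENNReal.ofReal_zero]

lemma Q_eq_coe (hA : IsNonnegWeights A) (hs : s ∈ weightMomentDomain P A) :
    Q P A s = (((weightMoment P A s).toReal - 1 : ℝ) : EReal) := by
  rw [Q, momentSum_eq_weightMoment hA hs.1.ne', ← EReal.coe_ennreal_toReal hs.2.ne]
  norm_cast

lemma spectral_eq_coe (hA : IsNonnegWeights A) (hs : s ∈ weightMomentDomain P A) :
    spectral P A s = ((((weightMoment P A s).toReal - 1) / s : ℝ) : EReal) := by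
  rw [spectral, Q_eq_coe hA hs, EReal.coe_div]

lemma spectral_lt_top_iff (hA : IsNonnegWeights A) (hs : 0 < s) :
    spectral P A s < ⊤ ↔ s ∈ weightMomentDomain P A := by
  refine ⟨fun h => ⟨hs, ?_⟩, fun h => spectral_eq_coe hA h ▸ EReal.coe_lt_top _⟩
  contrapose! h
  rw [top_le_iff] at h
  rw [spectral, Q, momentSum_eq_weightMoment hA hs.ne', h, EReal.coe_ennreal_top,
    show (⊤ : EReal) - 1 = ⊤ from rfl,
    EReal.top_div_of_pos_ne_top (EReal.coe_pos.2 hs) (EReal.coe_ne_top s)]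

/-- The function `s ↦ Q s - s * μ γ`, which is convex, vanishes at `γ`, and has at `s > 0` the sign
of `μ s - μ γ`. -/
noncomputable def gap (P : Measure Ω) (A : Fin N → Ω → ℝ) (γ s : ℝ) : ℝ :=
  (weightMoment P A s).toReal - 1 - s * (((weightMoment P A γ).toReal - 1) / γ)

lemma convexOn_gap (hA : IsNonnegWeights A) (γ : ℝ) :
    ConvexOn ℝ (weightMomentDomain P A) (gap P A γ) := by
  have hconv := hA.convexOn_toReal_weightMoment (P := P)
  exact (hconv.sub (concaveOn_const 1 hconv.1)).sub
    ((LinearMap.mulRight ℝ (((weightMoment P A γ).toReal - 1) / γ)).concaveOn hconv.1)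

lemma continuousOn_gap (hA : IsNonnegWeights A) (γ : ℝ) {a b : ℝ}
    (ha : a ∈ weightMomentDomain P A) (hb : b ∈ weightMomentDomain P A) :
    ContinuousOn (gap P A γ) (Set.Icc a b) :=
  ((hA.continuousOn_toReal_weightMoment ha hb).sub continuousOn_const).sub
    (continuousOn_id.mul continuousOn_const)

lemma gap_self (hγ : γ ≠ 0) : gap P A γ γ = 0 := by
  rw [gap, mul_div_cancel₀ _ hγ, sub_self]

lemma spectral_lt_spectral_iff (hA : IsNonnegWeights A) (hγ : γ ∈ weightMomentDomain P A)
    (hs : 0 < s) :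
    spectral P A s < spectral P A γ ↔ s ∈ weightMomentDomain P A ∧ gap P A γ s < 0 := by
  rw [← and_iff_right_of_imp fun h : spectral P A s < spectral P A γ =>
    (spectral_lt_top_iff hA hs).1 (h.trans_le le_top)]
  refine and_congr_right fun hsD => ?_
  rw [spectral_eq_coe hA hsD, spectral_eq_coe hA hγ, EReal.coe_lt_coe_iff, div_lt_iff₀ hs, gap,
    sub_neg, mul_comm s]

lemma mem_otherRoots_iff (hA : IsNonnegWeights A) (hγ : γ ∈ weightMomentDomain P A) {q : ℝ} :
    q ∈ otherRoots P A γ ↔ q ∈ weightMomentDomain P A ∧ q ≠ γ ∧ gap P A γ q = 0 := by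
  have mem_of_eq (hq : 0 < q) (h : spectral P A q = spectral P A γ) :
      q ∈ weightMomentDomain P A :=
    (spectral_lt_top_iff hA hq).1 (h ▸ (spectral_lt_top_iff hA hγ.1).2 hγ)
  have eq_iff (hq : q ∈ weightMomentDomain P A) :
      spectral P A q = spectral P A γ ↔ gap P A γ q = 0 := by
    rw [spectral_eq_coe hA hq, spectral_eq_coe hA hγ, EReal.coe_eq_coe_iff, div_eq_iff hq.1.ne',
      gap, sub_eq_zero, mul_comm q]
  constructor
  · rintro ⟨hq, hqγ, h⟩
    exact ⟨mem_of_eq hq h, hqγ, (eq_iff (mem_of_eq hq h)).1 h⟩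
  · rintro ⟨hq, hqγ, h⟩
    exact ⟨hq.1, hqγ, (eq_iff hq).2 h⟩

lemma lt_qStar_iff (h : (otherRoots P A γ).Subsingleton) :
    (p : EReal) < qStar P A γ ↔ ∀ q ∈ otherRoots P A γ, p < q := by
  rcases h.eq_empty_or_singleton with h | ⟨q, h⟩ <;> simp [qStar, h]

lemma not_ae_eq_zero_of_spectral_lt (hA : IsNonnegWeights A) (hγ : γ ∈ weightMomentDomain P A)
    (hγδ : γ < δ) (hδ : spectral P A δ < spectral P A γ) : ¬∀ᵐ ω ∂P, ∀ i, A i ω = 0 := by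
  intro h0
  have hδ0 := hγ.1.trans hγδ
  have gap_neg := ((spectral_lt_spectral_iff hA hγ hδ0).1 hδ).2
  have one_lt : 1 < δ / γ := (one_lt_div hγ.1).2 hγδ
  rw [gap, (hA.weightMoment_eq_zero_iff hγ.1.ne').2 h0, (hA.weightMoment_eq_zero_iff hδ0.ne').2 h0,
    ENNReal.toReal_zero, ← mul_div_assoc, mul_comm, mul_div_assoc] at gap_neg
  linarith

variable (hA : IsNonnegWeights A) (hγ : γ ∈ weightMomentDomain P A) (hγδ : γ < δ)
  (hδ : spectral P A δ < spectral P A γ)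

include hA hγ hγδ hδ

lemma subsingleton_otherRoots : (otherRoots P A γ).Subsingleton := by
  obtain ⟨hδD, gap_neg⟩ := (spectral_lt_spectral_iff hA hγ (hγ.1.trans hγδ)).1 hδ
  intro q hq r hr
  rw [mem_otherRoots_iff hA hγ] at hq hr
  exact convexOn_root_unique (convexOn_gap hA γ) hγ hδD hγδ (gap_self hγ.1.ne') gap_neg
    hq.1 hq.2.2 hq.2.1 hr.1 hr.2.2 hr.2.1

lemma lt_qStar_and_spectral_lt_top_iff (hγp : γ < p) :
    (p : EReal) < qStar P A γ ∧ spectral P A p < ⊤ ↔ spectral P A p < spectral P A γ := by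
  have hp := hγ.1.trans hγp
  obtain ⟨hδD, gap_neg⟩ := (spectral_lt_spectral_iff hA hγ (hγ.1.trans hγδ)).1 hδ
  rw [and_comm, lt_qStar_iff (subsingleton_otherRoots hA hγ hγδ hδ), spectral_lt_top_iff hA hp,
    spectral_lt_spectral_iff hA hγ hp]
  refine and_congr_right fun hpD => ?_
  rw [neg_iff_forall_convexOn_root (convexOn_gap hA γ) hγ hδD hγδ (gap_self hγ.1.ne') gap_neg hpD
    hγp (continuousOn_gap hA γ hδD hpD)]
  simp only [mem_otherRoots_iff hA hγ, and_imp]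

end Spectral

section Weights

/-- The uniform distribution on `(0, 1]`. -/
noncomputable def uniformMeasure : Measure ℝ := volume.restrict (Set.Ioc 0 1)

instance isProbabilityMeasure_uniformMeasure : IsProbabilityMeasure uniformMeasure :=
  ⟨by simp [uniformMeasure]⟩

lemma ae_mem_Ioc_uniformMeasure : ∀ᵐ τ ∂uniformMeasure, τ ∈ Set.Ioc (0 : ℝ) 1 :=
  ae_restrict_mem measurableSet_Ioc

lemma integrable_rpow_uniformMeasure_iff {r : ℝ} :
    Integrable (fun τ : ℝ => |τ| ^ r) uniformMeasure ↔ -1 < r := by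
  rw [← intervalIntegral.integrableOn_Ioo_rpow_iff zero_lt_one,
    ← integrableOn_Ioc_iff_integrableOn_Ioo]
  refine integrable_congr ?_
  filter_upwards [ae_mem_Ioc_uniformMeasure] with τ hτ
  rw [abs_of_pos hτ.1]

-- For `r ≤ -1` both sides are `⊤`, as `ENNReal.ofReal (r + 1) = 0`.
lemma lintegral_rpow_uniformMeasure (r : ℝ) :
    ∫⁻ τ, ENNReal.ofReal (|τ| ^ r) ∂uniformMeasure = (ENNReal.ofReal (r + 1))⁻¹ := by
  have hnonneg : 0 ≤ᵐ[uniformMeasure] fun τ : ℝ => |τ| ^ r :=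
    ae_of_all _ fun τ => Real.rpow_nonneg (abs_nonneg τ) r
  rcases lt_or_ge (-1) r with hr | hr
  · have integral_eq : ∫ τ, |τ| ^ r ∂uniformMeasure = (r + 1)⁻¹ := by
      calc ∫ τ, |τ| ^ r ∂uniformMeasure
        _ = ∫ τ in (0 : ℝ)..1, τ ^ r := by
          rw [intervalIntegral.integral_of_le zero_le_one]
          refine integral_congr_ae ?_
          filter_upwards [ae_mem_Ioc_uniformMeasure] with τ hτ
          rw [abs_of_pos hτ.1]
        _ = (r + 1)⁻¹ := by
          rw [integral_rpow (.inl hr), Real.one_rpow, Real.zero_rpow (by linarith), sub_zero,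
            one_div]
    rw [← ofReal_integral_eq_lintegral_ofReal (integrable_rpow_uniformMeasure_iff.2 hr) hnonneg,
      integral_eq, ENNReal.ofReal_inv_of_pos (by linarith)]
  · rw [ENNReal.ofReal_of_nonpos (by linarith), ENNReal.inv_zero]
    contrapose! hr
    exact integrable_rpow_uniformMeasure_iff.1 ⟨Measurable.aestronglyMeasurable (by fun_prop),
      (hasFiniteIntegral_iff_ofReal hnonneg).2 hr.lt_top⟩

/-- The weights `A i ^ γ * τ ^ Q γ` on `Ω × (0, 1]` whose smoothing transform encodes the integral
equation. The absolute value makes them non-negative for all real `τ`. -/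
noncomputable def weights (P : Measure Ω) (A : Fin N → Ω → ℝ) (γ : ℝ) (i : Fin N) (x : Ω × ℝ) :
    ℝ :=
  A i x.1 ^ γ * |x.2| ^ (Q P A γ).toReal

lemma isNonnegWeights_weights (hA : IsNonnegWeights A) : IsNonnegWeights (weights P A γ) where
  measurable i := by
    have := hA.measurable
    unfold weights
    fun_prop
  nonneg i x := mul_nonneg (hA.rpow_nonneg γ i x.1) (Real.rpow_nonneg (abs_nonneg _) _)

lemma weightMoment_weights (hA : IsNonnegWeights A) (s : ℝ) :
    weightMoment (P.prod uniformMeasure) (weights P A γ) s =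
      weightMoment P A (γ * s) / ENNReal.ofReal ((Q P A γ).toReal * s + 1) := by
  have hm := hA.measurable
  rw [div_eq_mul_inv, ← lintegral_rpow_uniformMeasure, weightMoment, weightMoment,
    ← lintegral_prod_mul (by fun_prop) (by fun_prop)]
  refine lintegral_congr fun x => ?_
  rw [← ENNReal.ofReal_mul (hA.sum_rpow_nonneg _ _), Finset.sum_mul]
  congr 1
  refine Finset.sum_congr rfl fun i _ => ?_
  rw [weights, Real.mul_rpow (hA.rpow_nonneg _ _ _) (Real.rpow_nonneg (abs_nonneg _) _),
    ← Real.rpow_mul (hA.nonneg i _), ← Real.rpow_mul (abs_nonneg _)]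

lemma toReal_Q (hA : IsNonnegWeights A) (hγ : γ ∈ weightMomentDomain P A) :
    (Q P A γ).toReal = (weightMoment P A γ).toReal - 1 := by
  rw [Q_eq_coe hA hγ, EReal.toReal_coe]

lemma isNormalizedWeights_weights (hA : IsNonnegWeights A)
    (hA0 : ¬∀ᵐ ω ∂P, ∀ i, A i ω = 0) (hγ : γ ∈ weightMomentDomain P A) :
    IsNormalizedWeights (P.prod uniformMeasure) (weights P A γ) where
  toIsNonnegWeights := isNonnegWeights_weights hA
  weightMoment_one := by
    rw [weightMoment_weights hA, mul_one, mul_one, toReal_Q hA hγ, sub_add_cancel,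
      ENNReal.ofReal_toReal hγ.2.ne]
    exact ENNReal.div_self (mt (hA.weightMoment_eq_zero_iff hγ.1.ne').1 hA0) hγ.2.ne

lemma weightMoment_weights_lt_one_iff (hA : IsNonnegWeights A)
    (hA0 : ¬∀ᵐ ω ∂P, ∀ i, A i ω = 0) (hγ : γ ∈ weightMomentDomain P A) (hp : 0 < p) :
    weightMoment (P.prod uniformMeasure) (weights P A γ) (p / γ) < 1 ↔
      spectral P A p < spectral P A γ := by
  set c := (Q P A γ).toReal * (p / γ) + 1 with hc
  have gap_eq : gap P A γ p = (weightMoment P A p).toReal - c := by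
    rw [gap, hc, toReal_Q hA hγ]
    ring
  calc weightMoment (P.prod uniformMeasure) (weights P A γ) (p / γ) < 1
    _ ↔ weightMoment P A p < ENNReal.ofReal c := by
      rw [weightMoment_weights hA, mul_div_cancel₀ _ hγ.1.ne', ENNReal.div_lt_iff
        (.inr (mt (hA.weightMoment_eq_zero_iff hp.ne').1 hA0)) (.inl ENNReal.ofReal_ne_top),
        one_mul]
    _ ↔ weightMoment P A p < ⊤ ∧ (weightMoment P A p).toReal < c := by
      rw [← and_iff_right_of_imp fun h : _ < ENNReal.ofReal c => h.trans ENNReal.ofReal_lt_top]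
      exact and_congr_right fun h => ENNReal.lt_ofReal_iff_toReal_lt h.ne
    _ ↔ spectral P A p < spectral P A γ := by
      rw [spectral_lt_spectral_iff hA hγ hp, gap_eq, sub_neg, weightMomentDomain,
        Set.mem_ofPred_eq, and_iff_right hp]

lemma solvesEq_charFun_iff [IsProbabilityMeasure P] (hA : IsNonnegWeights A) (ζ : Measure ℝ)
    [IsProbabilityMeasure ζ] :
    SolvesEq P A γ (charFun ζ) ↔
      Function.IsFixedPt (smoothing (P.prod uniformMeasure) (weights P A γ)) ζ := by
  have hm := (isNonnegWeights_weights (P := P) (γ := γ) hA).measurable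
  have := isProbabilityMeasure_smoothing (P := P.prod uniformMeasure) hm ζ
  have integral_eq_charFun (ξ : ℝ) : ∫ τ in (0 : ℝ)..1,
      ∫ ω, ∏ i, charFun ζ (ξ * A i ω ^ γ * τ ^ (Q P A γ).toReal) ∂P =
        charFun (smoothing (P.prod uniformMeasure) (weights P A γ) ζ) ξ := by
    rw [charFun_smoothing hm, integral_prod_symm _ (integrable_prod_charFun hm ζ ξ),
      intervalIntegral.integral_of_le zero_le_one]
    refine integral_congr_ae ?_
    filter_upwards [ae_mem_Ioc_uniformMeasure] with τ hτ
    simp only [weights, abs_of_pos hτ.1, mul_assoc]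
  simp only [SolvesEq, integral_eq_charFun]
  exact ⟨fun h => Measure.ext_of_charFun (funext fun ξ => (h ξ).symm),
    fun h ξ => by rw [h.eq]⟩

lemma isMeanOneSolution_iff [IsProbabilityMeasure P] (hA : IsNonnegWeights A) {ζ : Measure ℝ} :
    IsMeanOneSolution P A γ ζ ↔ IsMeanOne ζ ∧
      Function.IsFixedPt (smoothing (P.prod uniformMeasure) (weights P A γ)) ζ := by
  have supported_iff : ζ (Set.Iio 0) = 0 ↔ ∀ᵐ z ∂ζ, 0 ≤ z := by
    simp only [measure_eq_zero_iff_ae_notMem, Set.mem_Iio, not_lt]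
  constructor
  · intro h
    have := h.isProbabilityMeasure
    have hnonneg := supported_iff.1 h.supported
    refine ⟨⟨this, hnonneg, ?_⟩, (solvesEq_charFun_iff hA ζ).1 h.solves⟩
    simp only [moment, Real.rpow_one]
    rw [← ofReal_integral_eq_lintegral_ofReal h.integrable hnonneg, h.mean_eq_one,
      ENNReal.ofReal_one]
  · rintro ⟨h, hfix⟩
    have := h.isProbabilityMeasure
    exact ⟨this, supported_iff.2 h.ae_nonneg, h.integrable_id, h.integral_id,
      (solvesEq_charFun_iff hA ζ).2 hfix⟩

lemma eq_one_of_ae_mul_rpow_eq_one {c q : ℝ} (h : ∀ᵐ τ ∂uniformMeasure, c * |τ| ^ q = 1) :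
    c = 1 := by
  have hcont : ContinuousOn (fun τ : ℝ => c * |τ| ^ q) (Set.Ioc 0 1) :=
    continuousOn_const.mul <| continuous_abs.continuousOn.rpow_const fun τ hτ =>
      .inl (abs_ne_zero.2 hτ.1.ne')
  have eqOn := Measure.eqOn_Ioc_of_ae_eq volume h hcont continuousOn_const
  simpa using eqOn (Set.right_mem_Ioc.2 zero_lt_one)

lemma ae_sum_weights_eq_one_iff [IsProbabilityMeasure P] (hA : IsNonnegWeights A)
    (hγ : γ ∈ weightMomentDomain P A) :
    (∀ᵐ x ∂(P.prod uniformMeasure), ∑ i, weights P A γ i x = 1) ↔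
      ∀ᵐ ω ∂P, ∑ i, A i ω ^ γ = 1 := by
  simp only [weights, ← Finset.sum_mul]
  constructor
  · intro h
    filter_upwards [Measure.ae_ae_of_ae_prod h] with ω hω
    exact eq_one_of_ae_mul_rpow_eq_one hω
  · intro h
    have hQ : (Q P A γ).toReal = 0 := by
      rw [toReal_Q hA hγ, ← hA.integral_sum_rpow, integral_congr_ae h]
      simp
    filter_upwards [Measure.quasiMeasurePreserving_fst.ae h] with x hx
    rw [hQ, Real.rpow_zero, mul_one, hx]

end Weights

end KacLike

theorem proposition1_general {Ω : Type*} [MeasurableSpace Ω] (P : Measure Ω)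
    [IsProbabilityMeasure P] {N : ℕ} (A : Fin N → Ω → ℝ) (hmeas : ∀ i, Measurable (A i))
    (hnonneg : ∀ i ω, 0 ≤ A i ω) (γ : ℝ) (hγ0 : 0 < γ)
    (hδ : ∃ δ : ℝ, γ < δ ∧ KacLike.spectral P A δ < KacLike.spectral P A γ)
    (hfin : KacLike.spectral P A γ < ⊤) :
    (∃! ζ : Measure ℝ, KacLike.IsMeanOneSolution P A γ ζ) ∧
    (KacLike.otherRoots P A γ).Subsingleton ∧
    ∀ ζ : Measure ℝ, KacLike.IsMeanOneSolution P A γ ζ →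
      ((∃ c : ℝ, ζ = Measure.dirac c) ↔ ∀ᵐ ω ∂P, ∑ i, A i ω ^ γ = 1) ∧
      ∀ p : ℝ, γ < p →
        (∫⁻ z, ENNReal.ofReal (z ^ (p / γ)) ∂ζ < ⊤ ↔
          (p : EReal) < KacLike.qStar P A γ ∧ KacLike.spectral P A p < ⊤) := by
  obtain ⟨δ, hγδ, hlt⟩ := hδ
  have hA : SmoothingTransform.IsNonnegWeights A := ⟨hmeas, hnonneg⟩
  have hγ := (KacLike.spectral_lt_top_iff hA hγ0).1 hfin
  have hA0 := KacLike.not_ae_eq_zero_of_spectral_lt hA hγ hγδ hlt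
  have hT := KacLike.isNormalizedWeights_weights hA hA0 hγ
  have one_lt_div_of_lt {p : ℝ} (hp : γ < p) : 1 < p / γ := (one_lt_div hγ0).2 hp
  have hs := one_lt_div_of_lt hγδ
  have hw := (KacLike.weightMoment_weights_lt_one_iff hA hA0 hγ (hγ0.trans hγδ)).2 hlt
  have hsub := hT.not_ae_subsingleton_of_weightMoment_lt_one hs.le hw
  obtain ⟨ζ₀, hone, hfix, hmoment⟩ :=
    SmoothingTransform.exists_isMeanOne_isFixedPt_smoothing hT hs hw
  simp only [KacLike.isMeanOneSolution_iff hA]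
  have huniq (ζ : Measure ℝ) (hζ : SmoothingTransform.IsMeanOne ζ ∧ _) : ζ = ζ₀ :=
    hT.eq_of_isFixedPt_smoothing (by linarith) hw hζ.1 hone hζ.2 hfix
  refine ⟨⟨ζ₀, ⟨hone, hfix⟩, huniq⟩, KacLike.subsingleton_otherRoots hA hγ hγδ hlt, ?_⟩
  intro ζ hζ
  obtain rfl := huniq ζ hζ
  refine ⟨?_, fun p hp => ?_⟩
  · rw [← KacLike.ae_sum_weights_eq_one_iff hA hγ]
    exact SmoothingTransform.exists_eq_dirac_iff_ae_sum_eq_one hT (by linarith) hw hone hfix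
  · rw [KacLike.lt_qStar_and_spectral_lt_top_iff hA hγ hγδ hlt hp,
      ← KacLike.weightMoment_weights_lt_one_iff hA hA0 hγ (hγ0.trans hp)]
    exact ⟨SmoothingTransform.weightMoment_lt_one_of_isFixedPt hT.toIsNonnegWeights hsub hone hfix
      (one_lt_div_of_lt hp), hmoment _ (one_lt_div_of_lt hp).le⟩

theorem proposition1 {Ω : Type*} [MeasurableSpace Ω] (P : MeasureTheory.Measure Ω)
    [MeasureTheory.IsProbabilityMeasure P] {N : ℕ} (A : Fin N → Ω → ℝ)
    (hA : KacLike.StandingAssumptions P A)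
    (γ : ℝ) (hγ0 : 0 < γ) (hγ2 : γ ≤ 2)
    (hδ : ∃ δ : ℝ, γ < δ ∧ KacLike.spectral P A δ < KacLike.spectral P A γ)
    (hfin : KacLike.spectral P A γ < ⊤) :
    (∃! ζ : MeasureTheory.Measure ℝ, KacLike.IsMeanOneSolution P A γ ζ) ∧
    (KacLike.otherRoots P A γ).Subsingleton ∧
    ∀ ζ : MeasureTheory.Measure ℝ, KacLike.IsMeanOneSolution P A γ ζ →
      ((∃ c : ℝ, ζ = MeasureTheory.Measure.dirac c) ↔ ∀ᵐ ω ∂P, ∑ i, A i ω ^ γ = 1) ∧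
      (P {ω | ∑ i, A i ω ^ γ = 1} < 1 → ∀ p : ℝ, γ < p →
        (∫⁻ z, ENNReal.ofReal (z ^ (p / γ)) ∂ζ < ⊤ ↔
          (p : EReal) < KacLike.qStar P A γ ∧ KacLike.spectral P A p < ⊤)) := by
  obtain ⟨hunique, hroots, hζ⟩ :=
    proposition1_general P A hA.measurable hA.nonneg γ hγ0 hδ hfin
  exact ⟨hunique, hroots, fun ζ h => ⟨(hζ ζ h).1, fun _ => (hζ ζ h).2⟩⟩
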